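/- All Hilbert spaces are finite dimensional, $|X|$ is the dimension of $X$, and $\log$ is to base $2$. $\|M\|_p := (\mathrm{Tr}\,(M^\dagger M)^{p/2})^{1/p}$ is the Schatten norm. A subnormalised density matrix is a positive semidefinite matrix of trace at most one. For a subnormalised density matrix $\alpha$ and a positive semidefinite $\beta$ on the same space let $$D_2(\alpha\|\beta) := 2\log\|\beta^{-1/4}\alpha\beta^{-1/4}\|_2 \ \text{ if } \mathrm{supp}(\alpha)\subseteq\mathrm{supp}(\beta), \qquad D_2(\alpha\|\beta) := +\infty \ \text{ otherwise},$$ where negative powers are taken on the support of $\beta$ and are zero on its orthogonal complement, and $\log 0=-\infty$. For $0<\epsilon<1$ let $$D_2^\epsilon(\alpha\|\beta) := \inf_{\alpha'} D_2(\alpha'\|\beta),$$ the infimum being over all subnormalised density matrices $\alpha'$ with $\|\alpha'-\alpha\|_1\le\epsilon\,\mathrm{Tr}\,\alpha$. For a subnormalised density matrix $\rho^{XY}$ with marginal $\rho^Y$ let $H_2^\epsilon(X|Y)_\rho := -D_2^\epsilon(\rho^{XY}\,\|\,1^X\otimes\rho^Y)$. **Theorem.** Let $k$ be a positive integer, let $A_1,\dots,A_k$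 be Hilbert spaces with $|A_i|\ge 2$, and let $B$, $R$ be Hilbert spaces. Let $\mathcal T^{A_1\cdots A_k\to B}$ be a completely positive trace non-increasing superoperator with Choi state $$\tau^{A'_1\cdots A'_kB} := (\mathcal T\otimes\mathbb I^{A'_1\cdots A'_k})(\Phi^{A'_1A_1}\otimes\cdots\otimes\Phi^{A'_kA_k}),\qquad \Phi^{A'A} := |A|^{-1}\sum_{a,b=1}^{|A|}|a,a\rangle\langle b,b|^{A'A},$$ where $A'_i$ is a copy of $A_i$ and $\mathbb I$ is the identity superoperator. Let $\rho^{A_1\cdots A_kR}$ be a subnormalised density matrix. For unitaries $U^{A_i}$ on $A_i$ let $$\sigma^{BR}(U^{A_1},\dots,U^{A_k}) := (\mathcal T\otimes\mathbb I^R)\big((U^{A_1}\otimes\cdots\otimes U^{A_k}\otimes 1^R)\,\rho\,(U^{A_1}\otimes\cdots\otimes U^{A_k}\otimes 1^R)^\dagger\big).$$ For $\emptyset\ne S\subseteq[k]$ let $A_S:=\bigotimes_{s\in S}A_s$, $A'_S:=\bigotimes_{s\in S}A'_s$ and $D_S := 2^{|S|-1}\prod_{s\in S}(1-|A_s|^{-2})^{-1/2}$.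 Let $0<\epsilon<1$. Then $$\mathbb E_{U^{A_1},\dots,U^{A_k}}\big[\|\sigma^{BR}(U^{A_1},\dots,U^{A_k})-\tau^B\otimes\rho^R\|_1\big] \le 2(3^k-1)\epsilon+\sum_{\emptyset\ne S\subseteq[k]}2^{|S|}D_S\cdot 2^{-\frac12H_2^\epsilon(A_S|R)_\rho-\frac12H_2^\epsilon(A'_S|B)_\tau},$$ where the expectation is over independent $U^{A_1},\dots,U^{A_k}$, each distributed according to the Haar probability measure on the unitary group of $A_i$, the entropies are those of the marginals $\rho^{A_SR}$ and $\tau^{A'_SB}$, and $2^{-\infty}=0$. -/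

import Mathlib

open MeasureTheory
open scoped Matrix Kronecker ENNReal ComplexOrder

noncomputable section

namespace Decoupling

/-! Finite-dimensional systems are represented by finite index types (an orthonormal basis), the
dimension `|A|` being `Fintype.card A`; operators are complex matrices, and the tensor product of
systems corresponds to the product of index types. -/

/-- The Schatten-`p` norm `‖M‖_p = (Tr (M† M)^{p/2})^{1/p}`. -/
def schattenNorm {X : Type*} [Fintype X] [DecidableEq X] (p : ℝ) (M : Matrix X X ℂ) : ℝ :=
  (cfc (fun x : ℝ => x ^ (p / 2)) (Mᴴ * M)).trace.re ^ (1 / p)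

/-- A subnormalised density matrix: positive semidefinite with trace at most one. -/
def IsSubnormalised {X : Type*} [Fintype X] (α : Matrix X X ℂ) : Prop :=
  α.PosSemidef ∧ α.trace.re ≤ 1

/-- The power `β ^ s` of a positive semidefinite matrix taken on the support of `β`, and zero on the
orthogonal complement of the support (Moore–Penrose convention for `s < 0`). -/
def suppPow {X : Type*} [Fintype X] [DecidableEq X] (β : Matrix X X ℂ) (s : ℝ) : Matrix X X ℂ :=
  cfc (fun x : ℝ => if x = 0 then 0 else x ^ s) β

/-- The support of a Hermitian matrix, i.e. the span of the eigenvectors with non-zero eigenvalue,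
which is its range. -/
def supp {X : Type*} [Fintype X] (M : Matrix X X ℂ) : Submodule ℂ (X → ℂ) :=
  LinearMap.range M.mulVecLin

/-- Logarithm to base two on the non-negative reals, with `log 0 = -∞`. -/
def elog2 (x : ℝ) : EReal :=
  if x ≤ 0 then ⊥ else ((Real.logb 2 x : ℝ) : EReal)

/-- The function `x ↦ 2 ^ x` on the extended reals, with `2 ^ (-∞) = 0` and `2 ^ (+∞) = +∞`. -/
def epow2 (x : EReal) : ℝ≥0∞ :=
  if x = ⊥ then 0 else if x = ⊤ then ⊤ else ENNReal.ofReal ((2 : ℝ) ^ x.toReal)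

open Classical in
/-- The Rényi-2 divergence `D₂(α‖β) = 2 log ‖β^{-1/4} α β^{-1/4}‖₂` if `supp α ≤ supp β`, and `+∞`
otherwise. -/
def renyiDiv {X : Type*} [Fintype X] [DecidableEq X] (α β : Matrix X X ℂ) : EReal :=
  if supp α ≤ supp β then
    2 * elog2 (schattenNorm 2 (suppPow β (-1 / 4) * α * suppPow β (-1 / 4)))
  else ⊤

/-- The smooth Rényi-2 divergence: the infimum of `D₂(α'‖β)` over the subnormalised density
matrices `α'` with `‖α' - α‖₁ ≤ ε Tr α`. -/
def smoothRenyiDiv {X : Type*} [Fintype X] [DecidableEq X] (ε : ℝ) (α β : Matrix X X ℂ) : EReal :=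
  ⨅ α' ∈ {α' : Matrix X X ℂ |
      IsSubnormalised α' ∧ schattenNorm 1 (α' - α) ≤ ε * α.trace.re},
    renyiDiv α' β

/-- Partial trace over the first system. -/
def traceFst {X Y : Type*} [Fintype X] (M : Matrix (X × Y) (X × Y) ℂ) : Matrix Y Y ℂ :=
  Matrix.of fun y y' => ∑ x, M (x, y) (x, y')

/-- The smooth conditional Rényi-2 entropy
`H₂^ε(X|Y)_ρ = - D₂^ε(ρ^{XY} ‖ 1^X ⊗ ρ^Y)` of a matrix on the systems `X Y`. -/
def smoothCondEntropy {X Y : Type*} [Fintype X] [DecidableEq X] [Fintype Y] [DecidableEq Y]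
    (ε : ℝ) (ρ : Matrix (X × Y) (X × Y) ℂ) : EReal :=
  -smoothRenyiDiv ε ρ ((1 : Matrix X X ℂ) ⊗ₖ traceFst ρ)

/-- The extension `T ⊗ I^R` of a superoperator `T : X → Y` by the identity on `R`. -/
def ampliate {X Y : Type*} (R : Type*)
    (T : Matrix X X ℂ →ₗ[ℂ] Matrix Y Y ℂ) (M : Matrix (X × R) (X × R) ℂ) :
    Matrix (Y × R) (Y × R) ℂ :=
  Matrix.of fun p q => T (Matrix.of fun x x' => M (x, p.2) (x', q.2)) p.1 q.1

/-- Complete positivity: `T ⊗ I` preserves positive semidefiniteness for every finite ancilla. -/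
def IsCompletelyPositive {X Y : Type*} [Fintype X] [Fintype Y]
    (T : Matrix X X ℂ →ₗ[ℂ] Matrix Y Y ℂ) : Prop :=
  ∀ (n : ℕ) (M : Matrix (X × Fin n) (X × Fin n) ℂ),
    M.PosSemidef → (ampliate (Fin n) T M).PosSemidef

/-- `T` does not increase the trace of positive semidefinite matrices. -/
def IsTraceNonincreasing {X Y : Type*} [Fintype X] [Fintype Y]
    (T : Matrix X X ℂ →ₗ[ℂ] Matrix Y Y ℂ) : Prop :=
  ∀ M : Matrix X X ℂ, M.PosSemidef → (T M).trace.re ≤ M.trace.re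

section Multipartite

variable {k : ℕ} {A : Fin k → Type*} [∀ i, Fintype (A i)] [∀ i, DecidableEq (A i)]

/-- The tensor product of a family of local operators, one for each `A i`. -/
def tensorOp (V : ∀ i, Matrix (A i) (A i) ℂ) : Matrix (∀ i, A i) (∀ i, A i) ℂ :=
  Matrix.of fun x y => ∏ i, V i (x i) (y i)

/-- The EPR state `|X|⁻¹ ∑_{a, b} |a, a⟩⟨b, b|`. -/
def epr (X : Type*) [Fintype X] [DecidableEq X] : Matrix (X × X) (X × X) ℂ :=
  Matrix.of fun p q => if p.1 = p.2 ∧ q.1 = q.2 then (Fintype.card X : ℂ)⁻¹ else 0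

/-- The tensor product of the EPR states of all pairs `A i, A' i`, as a matrix on
`(A 1 ⋯ A k) (A' 1 ⋯ A' k)`; here `A' i` is a copy of `A i`. -/
def eprAll (A : Fin k → Type*) [∀ i, Fintype (A i)] [∀ i, DecidableEq (A i)] :
    Matrix ((∀ i, A i) × (∀ i, A i)) ((∀ i, A i) × (∀ i, A i)) ℂ :=
  Matrix.of fun p q => ∏ i, epr (A i) (p.1 i, p.2 i) (q.1 i, q.2 i)

/-- The Choi state of `T : A 1 ⋯ A k → B`, as a matrix on `(A' 1 ⋯ A' k) B`. -/
def choiState {B : Type*} (T : Matrix (∀ i, A i) (∀ i, A i) ℂ →ₗ[ℂ] Matrix B B ℂ) :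
    Matrix ((∀ i, A i) × B) ((∀ i, A i) × B) ℂ :=
  (ampliate (∀ i, A i) T (eprAll A)).submatrix Prod.swap Prod.swap

/-- The marginal on `A_S C` of a matrix on `(A 1 ⋯ A k) C`: the partial trace over all `A i` with
`i ∉ S`. -/
def marginal {C : Type*} (S : Finset (Fin k))
    (M : Matrix ((∀ i, A i) × C) ((∀ i, A i) × C) ℂ) :
    Matrix ((∀ i : {i // i ∈ S}, A i) × C) ((∀ i : {i // i ∈ S}, A i) × C) ℂ :=
  Matrix.of fun p q => ∑ z : (∀ i : {i // ¬ i ∈ S}, A i),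
    M ((Equiv.piEquivPiSubtypeProd (· ∈ S) A).symm (p.1, z), p.2)
      ((Equiv.piEquivPiSubtypeProd (· ∈ S) A).symm (q.1, z), q.2)

/-- The unitarily perturbed state
`(T ⊗ I^R)((U 1 ⊗ ⋯ ⊗ U k ⊗ 1^R) ρ (U 1 ⊗ ⋯ ⊗ U k ⊗ 1^R)†)`. -/
def perturbedState {B R : Type*} [Fintype R] [DecidableEq R]
    (T : Matrix (∀ i, A i) (∀ i, A i) ℂ →ₗ[ℂ] Matrix B B ℂ)
    (ρ : Matrix ((∀ i, A i) × R) ((∀ i, A i) × R) ℂ)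
    (U : ∀ i, Matrix.unitaryGroup (A i) ℂ) : Matrix (B × R) (B × R) ℂ :=
  ampliate R T
    ((tensorOp (fun i => (U i : Matrix (A i) (A i) ℂ)) ⊗ₖ (1 : Matrix R R ℂ)) * ρ *
      (tensorOp (fun i => (U i : Matrix (A i) (A i) ℂ)) ⊗ₖ (1 : Matrix R R ℂ))ᴴ)

/-- `D_S = 2^{|S|-1} ∏_{s ∈ S} (1 - |A_s|^{-2})^{-1/2}`. -/
def coeffD (A : Fin k → Type*) [∀ i, Fintype (A i)] (S : Finset (Fin k)) : ℝ :=
  (2 : ℝ) ^ ((S.card : ℤ) - 1) *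
    ∏ s ∈ S, (1 - ((Fintype.card (A s) : ℝ) ^ 2)⁻¹) ^ (-1 / 2 : ℝ)

end Multipartite

section Haar

variable (X : Type*) [Fintype X] [DecidableEq X]

instance : MeasurableSpace (Matrix.unitaryGroup X ℂ) := borel _

instance : BorelSpace (Matrix.unitaryGroup X ℂ) := ⟨rfl⟩

instance : CompactSpace (Matrix.unitaryGroup X ℂ) := by
  refine isCompact_iff_compactSpace.mp ?_
  have hK : IsCompact (Set.pi Set.univ fun _ : X => Set.pi Set.univ fun _ : X =>
      Metric.closedBall (0 : ℂ) 1) :=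
    isCompact_univ_pi fun _ => isCompact_univ_pi fun _ => isCompact_closedBall _ _
  refine hK.of_isClosed_subset (isClosed_unitary (R := Matrix X X ℂ)) ?_
  intro U hU i _ j _
  simpa using entry_norm_bound_of_unitary hU i j

/-- The Haar probability measure on the unitary group: the Haar measure giving mass one to the whole
(compact) group. -/
def haarUnitary : Measure (Matrix.unitaryGroup X ℂ) :=
  Measure.haarMeasure ⊤

end Haar

end Decoupling

end

/-! Conjugation by a unitary is encoded by a kernel on two copies of the space whose Haar mean is
the identity. Splitting each kernel into this mean and a centred part and expanding the tensor
product writes the deviation of the perturbed state from `τ ⊗ ρ` as a sum over the nonempty sets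
`S`, where the `S` term is a contraction of the marginals of `τ` and `ρ` on `S` with centred
kernels.

Invariance of the Haar measure under diagonal phases, permutations and a single reflection
determines the fourth moments of the entries; they show that the covariance of a centred kernel is
`(1 - |A|⁻²)⁻¹ (1 - Φ) ⊗ (1 - Φ)` with the projection `Φ = epr A`. Covariances multiply over tensor
factors, and bounding the projections by `1` gives the second moment of the Hilbert-Schmidt norm of
the `S` term. Hölder's inequality with the weights `(ρ^R)^{1/4}` and `(τ^B)^{1/4}` turns this into a
bound on its trace norm by Rényi-2 divergences.

For the smoothing, replacing kernel minus mean by kernel plus mean dominates the trace norm of the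
`S` term by a trace whose expectation is at most `2^{|S|}` times the product of the trace norms, so
that replacing both marginals by states at distance `ε` costs `2 * 2^{|S|} * ε`. -/

noncomputable section

namespace Decoupling

section SchattenNorm

variable {X : Type*} [Fintype X] [DecidableEq X] {M N C G P : Matrix X X ℂ}

lemma continuousOn_spectrum (f : ℝ → ℝ) (M : Matrix X X ℂ) : ContinuousOn f (spectrum ℝ M) :=
  (Matrix.finite_real_spectrum (A := M)).continuousOn f

lemma cfc_mul_matrix (f g : ℝ → ℝ) (M : Matrix X X ℂ) :
    cfc (fun x => f x * g x) M = cfc f M * cfc g M :=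
  cfc_mul f g M (continuousOn_spectrum f M) (continuousOn_spectrum g M)

open scoped MatrixOrder in
lemma posSemidef_cfc {f : ℝ → ℝ} (hf : ∀ x, 0 ≤ f x) (M : Matrix X X ℂ) :
    (cfc f M).PosSemidef :=
  Matrix.nonneg_iff_posSemidef.1 (cfc_nonneg fun x _ => hf x)

lemma schattenNorm_two (M : Matrix X X ℂ) : schattenNorm 2 M = √(Mᴴ * M).trace.re := by
  have h : cfc (fun x : ℝ => x ^ ((2 : ℝ) / 2)) (Mᴴ * M) = Mᴴ * M := by
    simpa only [div_self (two_ne_zero' ℝ), Real.rpow_one] using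
      cfc_id' ℝ _ (Matrix.isHermitian_conjTranspose_mul_self M).isSelfAdjoint
  rw [schattenNorm, h, Real.sqrt_eq_rpow]

lemma schattenNorm_two_nonneg (M : Matrix X X ℂ) : 0 ≤ schattenNorm 2 M := by
  rw [schattenNorm_two]
  exact Real.sqrt_nonneg _

lemma schattenNorm_two_sq (M : Matrix X X ℂ) : schattenNorm 2 M ^ 2 = (Mᴴ * M).trace.re := by
  rw [schattenNorm_two]
  exact Real.sq_sqrt (Complex.nonneg_iff.1
    (Matrix.posSemidef_conjTranspose_mul_self M).trace_nonneg).1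

lemma schattenNorm_two_sq_eq_sum (M : Matrix X X ℂ) :
    schattenNorm 2 M ^ 2 = ∑ i, ∑ j, ‖M i j‖ ^ 2 := by
  rw [schattenNorm_two_sq, Finset.sum_comm, Matrix.trace, Complex.re_sum]
  refine Finset.sum_congr rfl fun j _ => ?_
  rw [Matrix.diag_apply, Matrix.mul_apply, Complex.re_sum]
  refine Finset.sum_congr rfl fun i _ => ?_
  rw [Matrix.conjTranspose_apply, RCLike.star_def, Complex.conj_mul', ← Complex.ofReal_pow,
    Complex.ofReal_re]

lemma schattenNorm_two_eq_sqrt_sum (M : Matrix X X ℂ) :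
    schattenNorm 2 M = √(∑ i, ∑ j, ‖M i j‖ ^ 2) := by
  rw [← schattenNorm_two_sq_eq_sum, Real.sqrt_sq (schattenNorm_two_nonneg M)]

lemma re_trace_mul_le (M N : Matrix X X ℂ) :
    (M * N).trace.re ≤ schattenNorm 2 M * schattenNorm 2 N := by
  have hM : schattenNorm 2 M = √(∑ p : X × X, ‖M p.1 p.2‖ ^ 2) := by
    rw [schattenNorm_two_eq_sqrt_sum, Fintype.sum_prod_type]
  have hN : schattenNorm 2 N = √(∑ p : X × X, ‖N p.2 p.1‖ ^ 2) := by
    rw [schattenNorm_two_eq_sqrt_sum, Finset.sum_comm, Fintype.sum_prod_type]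
  calc (M * N).trace.re ≤ ‖∑ p : X × X, M p.1 p.2 * N p.2 p.1‖ := by
        simpa only [Matrix.trace, Matrix.diag_apply, Matrix.mul_apply, Fintype.sum_prod_type]
          using Complex.re_le_norm _
    _ ≤ ∑ p : X × X, ‖M p.1 p.2‖ * ‖N p.2 p.1‖ := by
        simpa only [norm_mul] using norm_sum_le Finset.univ fun p : X × X => M p.1 p.2 * N p.2 p.1
    _ ≤ schattenNorm 2 M * schattenNorm 2 N := by
        rw [hM, hN]
        exact Real.sum_mul_le_sqrt_mul_sqrt _ _ _

lemma schattenNorm_one (hM : M.IsHermitian) :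
    schattenNorm 1 M = (cfc (fun x : ℝ => |x|) M).trace.re := by
  have hsq : Mᴴ * M = cfc (fun x : ℝ => x * x) M := by
    rw [cfc_mul_matrix, cfc_id' ℝ M hM.isSelfAdjoint, hM.eq]
  have habs : cfc (fun x : ℝ => x ^ ((1 : ℝ) / 2)) (Mᴴ * M) = cfc (fun x : ℝ => |x|) M := by
    rw [hsq, ← cfc_comp' (fun x : ℝ => x ^ ((1 : ℝ) / 2)) (fun x => x * x) M
      (Set.Finite.continuousOn ((Matrix.finite_real_spectrum (A := M)).image _) _)
      (continuousOn_spectrum _ M) hM.isSelfAdjoint]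
    simp only [← Real.sqrt_eq_rpow, Real.sqrt_mul_self_eq_abs]
  rw [schattenNorm, habs, div_one, Real.rpow_one]

lemma exists_jordanDecomposition (hM : M.IsHermitian) :
    ∃ P N : Matrix X X ℂ, P.PosSemidef ∧ N.PosSemidef ∧ M = P - N ∧
      schattenNorm 1 M = P.trace.re + N.trace.re := by
  refine ⟨cfc (fun x : ℝ => max x 0) M, cfc (fun x : ℝ => max (-x) 0) M,
    posSemidef_cfc (fun x => le_max_right _ _) M, posSemidef_cfc (fun x => le_max_right _ _) M,
    ?_, ?_⟩
  · rw [← cfc_sub _ _ M (continuousOn_spectrum _ M) (continuousOn_spectrum _ M)]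
    conv_lhs => rw [← cfc_id' ℝ M hM.isSelfAdjoint]
    congr 1; ext x
    rcases le_total 0 x with h | h <;> simp [h]
  · rw [schattenNorm_one hM, ← Complex.add_re, ← Matrix.trace_add,
      ← cfc_add (a := M) _ _ (continuousOn_spectrum _ M) (continuousOn_spectrum _ M)]
    congr 3; ext x
    rcases le_total 0 x with h | h <;> simp [h, abs_of_nonneg, abs_of_nonpos]

lemma exists_sign (hM : M.IsHermitian) :
    ∃ C : Matrix X X ℂ, C.IsHermitian ∧ C * C = 1 ∧ schattenNorm 1 M = (C * M).trace.re := by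
  refine ⟨cfc (fun x : ℝ => if x < 0 then -1 else 1) M, cfc_predicate _ M, ?_, ?_⟩
  · rw [← cfc_mul_matrix]
    conv_rhs => rw [← cfc_const_one ℝ M hM.isSelfAdjoint]
    congr 1; ext x; split_ifs <;> simp
  · have habs : (fun x : ℝ => |x|) = fun x => (if x < 0 then -1 else 1) * x := by
      ext x
      split_ifs with h
      · rw [abs_of_neg h, neg_one_mul]
      · rw [abs_of_nonneg (not_lt.1 h), one_mul]
    rw [schattenNorm_one hM, habs, cfc_mul_matrix, cfc_id' ℝ M hM.isSelfAdjoint]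

lemma re_trace_mul_le_re_trace (hC : C.IsHermitian) (hC1 : C * C = 1) (hP : P.PosSemidef) :
    (C * P).trace.re ≤ P.trace.re := by
  have hpos := (hP.conjTranspose_mul_mul_same (1 - C)).trace_nonneg
  have hsq : (1 - C) * (1 - C) = (2 : ℂ) • (1 - C) := by
    rw [sub_mul, mul_sub, mul_sub, hC1, two_smul, one_mul, mul_one, one_mul]
    abel
  have htrace : ((1 - C)ᴴ * P * (1 - C)).trace = 2 * (P.trace - (C * P).trace) := by
    rw [(Matrix.isHermitian_one.sub hC).eq, Matrix.trace_mul_comm, ← mul_assoc, hsq,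
      Matrix.smul_mul, sub_mul, one_mul, Matrix.trace_smul, Matrix.trace_sub, smul_eq_mul]
  rw [htrace, Complex.le_def] at hpos
  simpa using hpos.1

lemma schattenNorm_one_sub_le (hP : P.PosSemidef) (hN : N.PosSemidef) :
    schattenNorm 1 (P - N) ≤ P.trace.re + N.trace.re := by
  obtain ⟨C, hC, hC1, h⟩ := exists_sign (hP.isHermitian.sub hN.isHermitian)
  have hCN := re_trace_mul_le_re_trace hC.neg (by rwa [neg_mul_neg]) hN
  have hCP := re_trace_mul_le_re_trace hC hC1 hP
  rw [neg_mul, Matrix.trace_neg, Complex.neg_re] at hCN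
  rw [h, mul_sub, Matrix.trace_sub, Complex.sub_re]
  linarith

lemma schattenNorm_one_zero : schattenNorm 1 (0 : Matrix X X ℂ) = 0 := by
  simp [schattenNorm_one Matrix.isHermitian_zero]

lemma schattenNorm_one_le_re_trace (hP : P.PosSemidef) : schattenNorm 1 P ≤ P.trace.re := by
  simpa using schattenNorm_one_sub_le hP Matrix.PosSemidef.zero

lemma IsSubnormalised.schattenNorm_one_le (hP : IsSubnormalised P) : schattenNorm 1 P ≤ 1 :=
  (schattenNorm_one_le_re_trace hP.1).trans hP.2

lemma schattenNorm_sub_comm (p : ℝ) (M N : Matrix X X ℂ) :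
    schattenNorm p (M - N) = schattenNorm p (N - M) := by
  rw [schattenNorm, schattenNorm, ← neg_sub N M, Matrix.conjTranspose_neg, neg_mul_neg]

lemma schattenNorm_one_nonneg (hM : M.IsHermitian) : 0 ≤ schattenNorm 1 M := by
  obtain ⟨P, N, hP, hN, -, h⟩ := exists_jordanDecomposition hM
  rw [h]
  exact add_nonneg (Complex.nonneg_iff.1 hP.trace_nonneg).1 (Complex.nonneg_iff.1 hN.trace_nonneg).1

lemma schattenNorm_one_add_le (hM : M.IsHermitian) (hN : N.IsHermitian) :
    schattenNorm 1 (M + N) ≤ schattenNorm 1 M + schattenNorm 1 N := by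
  obtain ⟨P, Q, hP, hQ, rfl, h⟩ := exists_jordanDecomposition hM
  obtain ⟨P', Q', hP', hQ', rfl, h'⟩ := exists_jordanDecomposition hN
  have hle := schattenNorm_one_sub_le (hP.add hP') (hQ.add hQ')
  simp only [Matrix.trace_add, Complex.add_re] at hle
  rw [sub_add_sub_comm]
  linarith

lemma schattenNorm_one_sum_le {ι : Type*} (s : Finset ι) {M : ι → Matrix X X ℂ}
    (hM : ∀ i, (M i).IsHermitian) :
    schattenNorm 1 (∑ i ∈ s, M i) ≤ ∑ i ∈ s, schattenNorm 1 (M i) := by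
  classical
  induction s using Finset.induction_on with
  | empty => rw [Finset.sum_empty, Finset.sum_empty, schattenNorm_one_zero]
  | insert i s hi ih =>
    rw [Finset.sum_insert hi, Finset.sum_insert hi]
    exact (schattenNorm_one_add_le (hM i) (isSelfAdjoint_sum s fun j _ => hM j)).trans
      (by gcongr)

/- Writing the trace norm as `Tr C(GNG) = Tr (GCG)N` for a sign `C`, Cauchy–Schwarz is applied
twice: to that trace, and to `‖GCG‖₂² = Tr (CG²)(CG²)`. -/
lemma schattenNorm_one_conj_le (hG : G.IsHermitian) (hN : N.IsHermitian) :
    schattenNorm 1 (G * N * G) ≤ √(G * G * (G * G)).trace.re * schattenNorm 2 N := by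
  have hGNG : (G * N * G).IsHermitian := by
    simpa only [hG.eq] using Matrix.isHermitian_conjTranspose_mul_mul G hN
  obtain ⟨C, hC, hC1, hnorm⟩ := exists_sign hGNG
  have hCGG : schattenNorm 2 (C * (G * G)) ^ 2 = (G * G * (G * G)).trace.re := by
    rw [schattenNorm_two_sq, Matrix.conjTranspose_mul, hC.eq, Matrix.conjTranspose_mul, hG.eq,
      mul_assoc (G * G), ← mul_assoc C, hC1, one_mul]
  have hGCG : schattenNorm 2 (G * C * G) ^ 2 ≤ schattenNorm 2 (C * (G * G)) ^ 2 := by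
    have htrace : ((G * C * G)ᴴ * (G * C * G)).trace = (C * (G * G) * (C * (G * G))).trace := by
      rw [Matrix.conjTranspose_mul, Matrix.conjTranspose_mul, hC.eq, hG.eq,
        Matrix.trace_mul_comm (C * (G * G)), mul_assoc G, Matrix.trace_mul_comm G]
      simp only [mul_assoc]
    rw [schattenNorm_two_sq, htrace, sq]
    exact re_trace_mul_le _ _
  calc schattenNorm 1 (G * N * G) = (G * C * G * N).trace.re := by
        rw [hnorm, ← mul_assoc, Matrix.trace_mul_comm]
        simp only [mul_assoc]
    _ ≤ schattenNorm 2 (G * C * G) * schattenNorm 2 N := re_trace_mul_le _ _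
    _ ≤ √(G * G * (G * G)).trace.re * schattenNorm 2 N := by
        refine mul_le_mul_of_nonneg_right (Real.le_sqrt_of_sq_le ?_) (schattenNorm_two_nonneg N)
        rwa [← hCGG]

lemma schattenNorm_one_le_sqrt_card_mul (hM : M.IsHermitian) :
    schattenNorm 1 M ≤ √(Fintype.card X) * schattenNorm 2 M := by
  simpa using schattenNorm_one_conj_le Matrix.isHermitian_one hM

lemma continuous_schattenNorm_two : Continuous fun M : Matrix X X ℂ => schattenNorm 2 M := by
  simp only [schattenNorm_two_eq_sqrt_sum]
  fun_prop

lemma continuous_schattenNorm_one {Ω : Type*} [TopologicalSpace Ω] {M : Ω → Matrix X X ℂ}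
    (hM : Continuous M) (hM' : ∀ ω, (M ω).IsHermitian) :
    Continuous fun ω => schattenNorm 1 (M ω) := by
  refine continuous_iff_continuousAt.2 fun ω₀ => tendsto_iff_dist_tendsto_zero.2 ?_
  have hdiff : ∀ ω ω', schattenNorm 1 (M ω) - schattenNorm 1 (M ω') ≤
      √(Fintype.card X) * schattenNorm 2 (M ω - M ω') := fun ω ω' => by
    have hH := (hM' ω).sub (hM' ω')
    have htri := schattenNorm_one_add_le hH (hM' ω')
    rw [sub_add_cancel] at htri
    linarith [schattenNorm_one_le_sqrt_card_mul hH]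
  have hlim : Filter.Tendsto (fun ω => √(Fintype.card X) * schattenNorm 2 (M ω - M ω₀))
      (nhds ω₀) (nhds 0) := by
    have hcont : Continuous fun ω => √(Fintype.card X) * schattenNorm 2 (M ω - M ω₀) :=
      continuous_const.mul (continuous_schattenNorm_two.comp (hM.sub continuous_const))
    simpa [schattenNorm_two_eq_sqrt_sum] using hcont.tendsto ω₀
  refine squeeze_zero (fun _ => dist_nonneg) (fun ω => ?_) hlim
  have hsymm : schattenNorm 2 (M ω₀ - M ω) = schattenNorm 2 (M ω - M ω₀) := by
    simp only [schattenNorm_two_eq_sqrt_sum, Matrix.sub_apply, norm_sub_rev]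
  exact abs_sub_le_iff.2 ⟨hdiff ω ω₀, hsymm ▸ hdiff ω₀ ω⟩

end SchattenNorm

section HaarMoments

variable {X : Type*} [Fintype X] [DecidableEq X]

instance : IsProbabilityMeasure (haarUnitary X) :=
  ⟨Measure.haarMeasure_self (K₀ := ⊤)⟩

instance : (haarUnitary X).IsMulLeftInvariant :=
  inferInstanceAs (Measure.haarMeasure _).IsMulLeftInvariant

instance : SecondCountableTopology (Matrix.unitaryGroup X ℂ) :=
  haveI : SecondCountableTopology (Matrix X X ℂ) :=
    inferInstanceAs (SecondCountableTopology (X → X → ℂ))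
  TopologicalSpace.Subtype.secondCountableTopology _

@[fun_prop]
lemma continuous_unitary_apply (a b : X) :
    Continuous fun U : Matrix.unitaryGroup X ℂ => (U : Matrix X X ℂ) a b :=
  (continuous_apply_apply a b).comp continuous_subtype_val

lemma integrable_of_continuous {Ω E : Type*} [TopologicalSpace Ω] [CompactSpace Ω]
    [MeasurableSpace Ω] [OpensMeasurableSpace Ω] {μ : Measure Ω} [IsFiniteMeasureOnCompacts μ]
    [NormedAddCommGroup E] [SecondCountableTopology E] {f : Ω → E} (hf : Continuous f) :
    Integrable f μ :=
  hf.integrable_of_hasCompactSupport (HasCompactSupport.of_compactSpace f)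

/-- The second moment `E[U_{ab} conj U_{a'b'}]` of a Haar random unitary. The column indices come
first, being mere parameters in the arguments based on left invariance. -/
def moment₂ (b b' a a' : X) : ℂ :=
  ∫ U : Matrix.unitaryGroup X ℂ, U.1 a b * star (U.1 a' b') ∂haarUnitary X

/-- The fourth moment `E[U_{ab} conj U_{a'b'} conj U_{ce} U_{c'e'}]` of a Haar random unitary, with
the column indices first as in `moment₂`. -/
def moment₄ (b b' e e' a a' c c' : X) : ℂ :=
  ∫ U : Matrix.unitaryGroup X ℂ,
    U.1 a b * (star (U.1 a' b') * (star (U.1 c e) * U.1 c' e')) ∂haarUnitary X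

lemma moment₄_eq_sum_mul_left (V : Matrix.unitaryGroup X ℂ) (b b' e e' a a' c c' : X) :
    moment₄ b b' e e' a a' c c' = ∑ i, V.1 a i * ∑ i', star (V.1 a' i') *
      ∑ j, star (V.1 c j) * ∑ j', V.1 c' j' * moment₄ b b' e e' i i' j j' := by
  have hexp : ∀ U : Matrix.unitaryGroup X ℂ,
      (V * U).1 a b * (star ((V * U).1 a' b') * (star ((V * U).1 c e) * (V * U).1 c' e')) =
      ∑ i, ∑ i', ∑ j, ∑ j', V.1 a i * (star (V.1 a' i') * (star (V.1 c j) * (V.1 c' j' *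
        (U.1 i b * (star (U.1 i' b') * (star (U.1 j e) * U.1 j' e')))))) := fun U => by
    have hmul : ∀ x y, (V * U).1 x y = ∑ i, V.1 x i * U.1 i y := fun x y => Matrix.mul_apply
    simp only [hmul, star_sum, star_mul', Finset.sum_mul]
    simp only [Finset.mul_sum]
    refine Finset.sum_congr rfl fun i _ => Finset.sum_congr rfl fun i' _ =>
      Finset.sum_congr rfl fun j _ => Finset.sum_congr rfl fun j' _ => ?_
    ring
  simp only [moment₄, Finset.mul_sum, ← integral_const_mul]
  rw [← integral_mul_left_eq_self _ V]
  simp only [hexp]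
  rw [integral_finsetSum _ fun _ _ => integrable_of_continuous (by fun_prop)]
  refine Finset.sum_congr rfl fun i _ => ?_
  rw [integral_finsetSum _ fun _ _ => integrable_of_continuous (by fun_prop)]
  refine Finset.sum_congr rfl fun i' _ => ?_
  rw [integral_finsetSum _ fun _ _ => integrable_of_continuous (by fun_prop)]
  refine Finset.sum_congr rfl fun j _ => ?_
  rw [integral_finsetSum _ fun _ _ => integrable_of_continuous (by fun_prop)]

lemma sum_mul_star_unitary (U : Matrix.unitaryGroup X ℂ) (b b' : X) :
    ∑ a, U.1 a b * star (U.1 a b') = if b = b' then 1 else 0 := by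
  have h : (star U.1 * U.1 : Matrix X X ℂ) b' b = (1 : Matrix X X ℂ) b' b := by
    rw [Matrix.mem_unitaryGroup_iff'.1 U.2]
  simpa only [Matrix.mul_apply, Matrix.star_apply, Matrix.one_apply, mul_comm (star _),
    eq_comm (a := b')] using h

/-- The diagonal unitary multiplying the coordinate `a` by `i`: it forces moments with unmatched
row indices to vanish. -/
def phaseUnitary (a : X) : Matrix.unitaryGroup X ℂ :=
  ⟨Matrix.diagonal fun x => if x = a then Complex.I else 1, by
    rw [Matrix.mem_unitaryGroup_iff, Matrix.star_eq_conjTranspose, Matrix.diagonal_conjTranspose,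
      Matrix.diagonal_mul_diagonal, ← Matrix.diagonal_one]
    congr 1; ext x; by_cases h : x = a <;> simp [h]⟩

/-- The matrix of a permutation: it makes moments depend on the pattern of their row indices only.
-/
def permUnitary (s : Equiv.Perm X) : Matrix.unitaryGroup X ℂ :=
  ⟨Matrix.of fun x y => if y = s x then 1 else 0, by
    rw [Matrix.mem_unitaryGroup_iff]
    ext x y
    simp [Matrix.mul_apply, Matrix.one_apply, eq_comm]⟩

/-- The reflection with rows `(3/5, 4/5)` and `(4/5, -3/5)` in the plane of `a` and `c`, a unitary
with rational entries that mixes two coordinates. -/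
def reflUnitary {a c : X} (hac : a ≠ c) : Matrix.unitaryGroup X ℂ :=
  ⟨1 - (2 / 5 : ℂ) • Matrix.vecMulVec (Pi.single a 1 - Pi.single c 2 : X → ℂ)
      (Pi.single a 1 - Pi.single c 2), by
    have hnorm : (Pi.single a 1 - Pi.single c 2 : X → ℂ) ⬝ᵥ
        (Pi.single a 1 - Pi.single c 2) = 5 := by
      simp [hac, hac.symm]; norm_num
    have hstar : star (Pi.single a 1 - Pi.single c 2 : X → ℂ) =
        Pi.single a 1 - Pi.single c 2 := by
      rw [star_sub, ← Pi.single_star, ← Pi.single_star]; simp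
    rw [Matrix.mem_unitaryGroup_iff, Matrix.star_eq_conjTranspose, Matrix.conjTranspose_sub,
      Matrix.conjTranspose_smul, Matrix.conjTranspose_vecMulVec, hstar, Matrix.conjTranspose_one,
      sub_mul, mul_sub, mul_sub, smul_mul_smul_comm, Matrix.vecMulVec_mul_vecMulVec, hnorm]
    ext i j
    simp
    ring⟩

lemma reflUnitary_apply {a c : X} (hac : a ≠ c) (i : X) :
    (reflUnitary hac).1 a i = (if i = a then 3 / 5 else 0) + (if i = c then 4 / 5 else 0) := by
  simp only [reflUnitary, Matrix.sub_apply, Matrix.smul_apply, Matrix.vecMulVec_apply,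
    Matrix.one_apply, Pi.sub_apply, Pi.single_apply, smul_eq_mul]
  rcases eq_or_ne i a with rfl | ha
  · norm_num [hac]
  · rcases eq_or_ne i c with rfl | hc
    · norm_num [hac, ha]
    · norm_num [hac, ha, ha.symm, hc]

lemma sum_reflUnitary_mul {a c : X} (hac : a ≠ c) (f : X → ℂ) :
    ∑ i, (reflUnitary hac).1 a i * f i = 3 / 5 * f a + 4 / 5 * f c := by
  simp [reflUnitary_apply, add_mul, Finset.sum_add_distrib]

lemma star_reflUnitary {a c : X} (hac : a ≠ c) (i : X) :
    star ((reflUnitary hac).1 a i) = (reflUnitary hac).1 a i := by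
  rw [reflUnitary_apply, star_add]
  congr 1 <;> split_ifs <;> simp

lemma phaseUnitary_mul_apply (x : X) (U : Matrix.unitaryGroup X ℂ) (a b : X) :
    (phaseUnitary x * U).1 a b = (if a = x then Complex.I else 1) * U.1 a b :=
  Matrix.diagonal_mul _ _ _ _

lemma permUnitary_mul_apply (s : Equiv.Perm X) (U : Matrix.unitaryGroup X ℂ) (a b : X) :
    (permUnitary s * U).1 a b = U.1 (s a) b :=
  (Matrix.mul_apply (M := (permUnitary s).1)).trans (by simp [permUnitary])

lemma moment₂_perm (s : Equiv.Perm X) (b b' a a' : X) :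
    moment₂ b b' (s a) (s a') = moment₂ b b' a a' := by
  unfold moment₂
  conv_rhs => rw [← integral_mul_left_eq_self _ (permUnitary s)]
  simp only [permUnitary_mul_apply]

lemma moment₄_perm (s : Equiv.Perm X) (b b' e e' a a' c c' : X) :
    moment₄ b b' e e' (s a) (s a') (s c) (s c') = moment₄ b b' e e' a a' c c' := by
  unfold moment₄
  conv_rhs => rw [← integral_mul_left_eq_self _ (permUnitary s)]
  simp only [permUnitary_mul_apply]

lemma moment₂_phase (x b b' a a' : X) :
    moment₂ b b' a a' = (if a = x then Complex.I else 1) *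
      star (if a' = x then Complex.I else 1) * moment₂ b b' a a' := by
  conv_lhs => rw [moment₂, ← integral_mul_left_eq_self _ (phaseUnitary x)]
  simp only [phaseUnitary_mul_apply, star_mul']
  rw [moment₂, ← integral_const_mul]
  congr 1; ext U
  ring

lemma moment₄_phase (x b b' e e' a a' c c' : X) :
    moment₄ b b' e e' a a' c c' = (if a = x then Complex.I else 1) *
      (star (if a' = x then Complex.I else 1) * (star (if c = x then Complex.I else 1) *
      (if c' = x then Complex.I else 1))) * moment₄ b b' e e' a a' c c' := by
  conv_lhs => rw [moment₄, ← integral_mul_left_eq_self _ (phaseUnitary x)]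
  simp only [phaseUnitary_mul_apply, star_mul']
  rw [moment₄, ← integral_const_mul]
  congr 1; ext U
  ring

lemma moment₂_eq_zero (b b' : X) {a a' : X} (h : a ≠ a') : moment₂ b b' a a' = 0 := by
  by_contra hne
  have hphase : (if a = a then Complex.I else 1) * star (if a' = a then Complex.I else 1) = 1 :=
    mul_right_cancel₀ hne (by rw [one_mul]; exact (moment₂_phase a b b' a a').symm)
  simp [h.symm, Complex.ext_iff] at hphase

lemma moment₄_eq_zero (b b' e e' : X) {a a' c c' : X} (h : ¬(a = a' ∧ c = c'))
    (h' : ¬(a = c ∧ a' = c')) : moment₄ b b' e e' a a' c c' = 0 := by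
  by_contra hne
  have hphase : ∀ x, (if a = x then Complex.I else 1) *
      (star (if a' = x then Complex.I else 1) * (star (if c = x then Complex.I else 1) *
      (if c' = x then Complex.I else 1))) = 1 := fun x =>
    mul_right_cancel₀ hne (by rw [one_mul]; exact (moment₄_phase x b b' e e' a a' c c').symm)
  rcases eq_or_ne a a' with rfl | haa'
  · have hcc' : c ≠ c' := fun hc => h ⟨rfl, hc⟩
    have hphase := hphase c'
    by_cases hac' : a = c' <;> simp [hac', hcc', Complex.ext_iff] at hphase
  · rcases eq_or_ne a c with rfl | hac
    · have ha'c' : a' ≠ c' := fun hc => h' ⟨rfl, hc⟩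
      have hphase := hphase c'
      by_cases hac' : a = c' <;> simp [hac', ha'c', Complex.ext_iff] at hphase
    · have hphase := hphase a
      by_cases hc'a : c' = a <;>
        norm_num [hc'a, haa'.symm, hac.symm, Complex.ext_iff] at hphase

lemma moment₂_eq (b b' a a' : X) : moment₂ b b' a a' = epr X (a, a') (b, b') := by
  rcases ne_or_eq a a' with ha | rfl
  · simp [epr, ha, moment₂_eq_zero b b' ha]
  have hsum : ∑ x, moment₂ b b' x x = if b = b' then 1 else 0 := by
    unfold moment₂
    rw [← integral_finsetSum _ fun _ _ => integrable_of_continuous (by fun_prop)]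
    simp only [sum_mul_star_unitary, integral_const, probReal_univ, one_smul]
  have hconst : ∀ x, moment₂ b b' x x = moment₂ b b' a a := fun x => by
    simpa only [Equiv.swap_apply_left] using moment₂_perm (Equiv.swap a x) b b' a a
  have hcard : (Fintype.card X : ℂ) ≠ 0 :=
    haveI : Nonempty X := ⟨a⟩
    Nat.cast_ne_zero.2 Fintype.card_ne_zero
  simp only [hconst, Finset.sum_const, Finset.card_univ, nsmul_eq_mul] at hsum
  simp only [epr, Matrix.of_apply, true_and]
  rw [← mul_right_inj' hcard, hsum, mul_ite, mul_inv_cancel₀ hcard, mul_zero]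

omit [Fintype X] [DecidableEq X] in
lemma exists_perm_map_pair {x y a c : X} (hxy : x ≠ y) (hac : a ≠ c) :
    ∃ s : Equiv.Perm X, s x = a ∧ s y = c := by
  classical
  refine ⟨Equiv.swap (Equiv.swap x a y) c * Equiv.swap x a, ?_, by simp⟩
  rw [Equiv.Perm.mul_apply, Equiv.swap_apply_left, Equiv.swap_apply_of_ne_of_ne _ hac]
  exact fun h => hxy ((Equiv.swap x a).injective (by rw [Equiv.swap_apply_left, ← h]))

lemma moment₄_diag (b b' e e' : X) {x y : X} (hxy : x ≠ y) :
    moment₄ b b' e e' x x x x =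
      moment₄ b b' e e' x x y y + moment₄ b b' e e' x y x y := by
  have hrefl := moment₄_eq_sum_mul_left (reflUnitary hxy) b b' e e' x x x x
  simp only [star_reflUnitary, sum_reflUnitary_mul] at hrefl
  have hswap : ∀ a a' c c', moment₄ b b' e e' (Equiv.swap x y a) (Equiv.swap x y a')
      (Equiv.swap x y c) (Equiv.swap x y c') = moment₄ b b' e e' a a' c c' :=
    moment₄_perm (Equiv.swap x y) b b' e e'
  have hxxxx := hswap x x x x
  have hxxyy := hswap x x y y
  have hxyxy := hswap x y x y
  simp only [Equiv.swap_apply_left, Equiv.swap_apply_right] at hxxxx hxxyy hxyxy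
  have hzero : ∀ {a a' c c'}, ¬(a = a' ∧ c = c') → ¬(a = c ∧ a' = c') →
      moment₄ b b' e e' a a' c c' = 0 := fun h h' => moment₄_eq_zero b b' e e' h h'
  rw [hxxxx, hxxyy, hxyxy, @hzero x x x y, @hzero x x y x, @hzero x y x x, @hzero x y y x,
    @hzero x y y y, @hzero y x x x, @hzero y x x y, @hzero y x y y, @hzero y y x y,
    @hzero y y y x] at hrefl
  · linear_combination (625 / 288 : ℂ) * hrefl
  all_goals simp [hxy, hxy.symm]

lemma moment₄_eq_add (b b' e e' : X) {x y : X} (hxy : x ≠ y) (a a' c c' : X) :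
    moment₄ b b' e e' a a' c c' =
      (if a = a' ∧ c = c' then moment₄ b b' e e' x x y y else 0) +
      (if a = c ∧ a' = c' then moment₄ b b' e e' x y x y else 0) := by
  by_cases h : a = a' ∧ c = c'
  · obtain ⟨rfl, rfl⟩ := h
    rcases eq_or_ne a c with rfl | hac
    · have hdiag := moment₄_perm (Equiv.swap x a) b b' e e' x x x x
      rw [Equiv.swap_apply_left, moment₄_diag b b' e e' hxy] at hdiag
      simpa using hdiag
    · obtain ⟨s, rfl, rfl⟩ := exists_perm_map_pair hxy hac
      simpa [hxy] using moment₄_perm s b b' e e' x x y y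
  · by_cases h' : a = c ∧ a' = c'
    · obtain ⟨rfl, rfl⟩ := h'
      obtain ⟨s, rfl, rfl⟩ := exists_perm_map_pair hxy fun haa' => h ⟨haa', haa'⟩
      simpa [hxy] using moment₄_perm s b b' e e' x y x y
    · simp [h, h', moment₄_eq_zero b b' e e' h h']

lemma sum_moment₄_left (b b' e e' c : X) :
    ∑ a, moment₄ b b' e e' a a c c = epr X (b, b') (e, e') := by
  have hmom := moment₂_eq e' e c c
  rw [moment₂] at hmom
  unfold moment₄
  rw [← integral_finsetSum _ fun _ _ => integrable_of_continuous (by fun_prop)]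
  simp only [← mul_assoc, ← Finset.sum_mul, sum_mul_star_unitary]
  simp only [mul_assoc, integral_const_mul, mul_comm (star _), hmom]
  by_cases hb : b = b' <;> by_cases he : e = e' <;> simp [epr, hb, he, eq_comm]

lemma sum_moment₄_right (b b' e e' c : X) :
    ∑ a, moment₄ b b' e e' a c a c =
      (Fintype.card X : ℂ)⁻¹ * (1 : Matrix (X × X) (X × X) ℂ) (b, b') (e, e') := by
  have hmom := moment₂_eq e' b' c c
  rw [moment₂] at hmom
  have hcomm : ∀ (U : Matrix.unitaryGroup X ℂ) (a : X),
      U.1 a b * (star (U.1 c b') * (star (U.1 a e) * U.1 c e')) =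
      U.1 a b * star (U.1 a e) * (U.1 c e' * star (U.1 c b')) := fun U a => by ring
  unfold moment₄
  rw [← integral_finsetSum _ fun _ _ => integrable_of_continuous (by fun_prop)]
  simp only [hcomm, ← Finset.sum_mul, sum_mul_star_unitary, integral_const_mul, hmom]
  by_cases hb : b = e <;> by_cases hb' : b' = e' <;>
    simp [epr, Matrix.one_apply, hb, hb', eq_comm]

/- By `moment₄_eq_add` the moment is `q E + r I` in the row indices, where `E` is the EPR matrix and
`I` the identity; the two contractions `sum_moment₄_left` and `sum_moment₄_right` determine `q` and
`r`. -/
lemma moment₄_eq (hX : 2 ≤ Fintype.card X) (b b' e e' a a' c c' : X) :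
    ((Fintype.card X : ℂ) ^ 2 - 1) * moment₄ b b' e e' a a' c c' =
      epr X (a, a') (c, c') * ((Fintype.card X : ℂ) ^ 2 * epr X (b, b') (e, e') -
        (1 : Matrix (X × X) (X × X) ℂ) (b, b') (e, e')) +
      (1 : Matrix (X × X) (X × X) ℂ) (a, a') (c, c') *
        ((1 : Matrix (X × X) (X × X) ℂ) (b, b') (e, e') - epr X (b, b') (e, e')) := by
  obtain ⟨x, y, hxy⟩ := Fintype.one_lt_card_iff.1 hX
  have hcard : (Fintype.card X : ℂ) ≠ 0 := Nat.cast_ne_zero.2 (by omega)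
  obtain ⟨q, r, hqr⟩ : ∃ q r, ∀ a a' c c', moment₄ b b' e e' a a' c c' =
      epr X (a, a') (c, c') * q + (1 : Matrix (X × X) (X × X) ℂ) (a, a') (c, c') * r := by
    refine ⟨Fintype.card X * moment₄ b b' e e' x x y y, moment₄ b b' e e' x y x y,
      fun a a' c c' => ?_⟩
    rw [moment₄_eq_add b b' e e' hxy]
    simp only [epr, Matrix.of_apply, Matrix.one_apply, Prod.mk.injEq, ite_mul, zero_mul, one_mul,
      inv_mul_cancel_left₀ hcard]
  have hleft : q + r = epr X (b, b') (e, e') := by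
    rw [← sum_moment₄_left b b' e e' x]
    simp only [hqr, Finset.sum_add_distrib, ← Finset.sum_mul, epr, Matrix.of_apply,
      Matrix.one_apply, Prod.mk.injEq, and_self, if_true, Finset.sum_const, Finset.card_univ,
      nsmul_eq_mul, mul_inv_cancel₀ hcard, Finset.sum_ite_eq', Finset.mem_univ, one_mul]
  have hright : (Fintype.card X : ℂ)⁻¹ * q + Fintype.card X * r =
      (Fintype.card X : ℂ)⁻¹ * (1 : Matrix (X × X) (X × X) ℂ) (b, b') (e, e') := by
    rw [← sum_moment₄_right b b' e e' x]
    simp only [hqr, Finset.sum_add_distrib, ← Finset.sum_mul, epr, Matrix.of_apply,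
      Matrix.one_apply, and_self, if_true, Finset.sum_const,
      Finset.card_univ, nsmul_eq_mul, mul_one, Finset.sum_ite_eq', Finset.mem_univ]
  have hright' : q + (Fintype.card X : ℂ) ^ 2 * r =
      (1 : Matrix (X × X) (X × X) ℂ) (b, b') (e, e') := by
    rw [← mul_right_inj' (inv_ne_zero hcard), ← hright, mul_add, sq, mul_assoc,
      inv_mul_cancel_left₀ hcard]
  rw [hqr, ← hright', ← hleft]
  ring

/-- The Choi matrix of conjugation by `U`, normalised so that its mean over the unitary group is
the identity. -/
def conjKernel (U : Matrix X X ℂ) : Matrix (X × X) (X × X) ℂ :=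
  (Fintype.card X : ℂ) • Matrix.of fun p q => U p.1 p.2 * star (U q.1 q.2)

/-- The deviation of `conjKernel U` from its mean. -/
def centredKernel (U : Matrix X X ℂ) : Matrix (X × X) (X × X) ℂ :=
  conjKernel U - 1

lemma one_apply_eq_card_mul_moment₂ (x y x' y' : X) :
    (1 : Matrix (X × X) (X × X) ℂ) (x, y) (x', y') = Fintype.card X * moment₂ y y' x x' := by
  have hcard : (Fintype.card X : ℂ) ≠ 0 :=
    haveI : Nonempty X := ⟨x⟩
    Nat.cast_ne_zero.2 Fintype.card_ne_zero
  simp only [moment₂_eq, epr, Matrix.of_apply, Matrix.one_apply, Prod.mk.injEq, mul_ite,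
    mul_inv_cancel₀ hcard, mul_zero]

lemma centredKernel_apply (U : Matrix X X ℂ) (x y x' y' : X) :
    centredKernel U (x, y) (x', y') =
      Fintype.card X * (U x y * star (U x' y') - moment₂ y y' x x') := by
  rw [centredKernel, Matrix.sub_apply, one_apply_eq_card_mul_moment₂, mul_sub]
  rfl

lemma integral_mul_star_sub_moment₂ (b b' e e' a a' c c' : X) :
    ∫ U : Matrix.unitaryGroup X ℂ, (U.1 a b * star (U.1 a' b') - moment₂ b b' a a') *
        star (U.1 c e * star (U.1 c' e') - moment₂ e e' c c') ∂haarUnitary X =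
      moment₄ b b' e e' a a' c c' - moment₂ b b' a a' * moment₂ e' e c' c := by
  have hstar : star (moment₂ e e' c c') = moment₂ e' e c' c := by
    rw [moment₂_eq, moment₂_eq]
    simp only [epr, Matrix.of_apply, eq_comm (a := c), eq_comm (a := e)]
    split_ifs <;> simp
  have hexp : ∀ U : Matrix.unitaryGroup X ℂ,
      (U.1 a b * star (U.1 a' b') - moment₂ b b' a a') *
        star (U.1 c e * star (U.1 c' e') - moment₂ e e' c c') =
      U.1 a b * (star (U.1 a' b') * (star (U.1 c e) * U.1 c' e')) -
        moment₂ e' e c' c * (U.1 a b * star (U.1 a' b')) -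
        (moment₂ b b' a a' * (U.1 c' e' * star (U.1 c e)) -
          moment₂ b b' a a' * moment₂ e' e c' c) := fun U => by
    rw [star_sub, star_mul', star_star, hstar]
    ring
  simp only [hexp]
  rw [integral_sub, integral_sub, integral_sub, integral_const_mul, integral_const_mul,
    integral_const, probReal_univ, one_smul, ← moment₂, ← moment₂, ← moment₄]
  · ring
  all_goals exact integrable_of_continuous (by fun_prop)

lemma integral_centredKernel_mul_star (hX : 2 ≤ Fintype.card X) (a a' b b' c c' e e' : X) :
    ∫ U : Matrix.unitaryGroup X ℂ, centredKernel U.1 (a, b) (a', b') *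
        star (centredKernel U.1 (c, e) (c', e')) ∂haarUnitary X =
      (1 - ((Fintype.card X : ℂ) ^ 2)⁻¹)⁻¹ *
        ((1 - epr X) (a, a') (c, c') * (1 - epr X) (b, b') (e, e')) := by
  have hcard : (Fintype.card X : ℂ) ≠ 0 := Nat.cast_ne_zero.2 (by omega)
  have hd : (Fintype.card X : ℂ) ^ 2 - 1 ≠ 0 := by
    have h : (1 : ℝ) < (Fintype.card X : ℝ) ^ 2 :=
      one_lt_pow₀ (by exact_mod_cast hX) two_ne_zero
    exact_mod_cast (sub_pos.2 h).ne'
  have hmoments : moment₂ b b' a a' * moment₂ e' e c' c =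
      epr X (a, a') (c, c') * epr X (b, b') (e, e') := by
    simp only [moment₂_eq, epr, Matrix.of_apply]
    by_cases ha : a = a' <;> by_cases hb : b = b' <;> by_cases hc : c = c' <;>
      by_cases he : e = e' <;> simp [ha, hb, hc, he, eq_comm]
  have hcoeff : (1 - ((Fintype.card X : ℂ) ^ 2)⁻¹)⁻¹ =
      (Fintype.card X : ℂ) ^ 2 / ((Fintype.card X : ℂ) ^ 2 - 1) := by
    rw [← inv_div, sub_div, div_self (pow_ne_zero 2 hcard), one_div]
  have hcov : moment₄ b b' e e' a a' c c' - moment₂ b b' a a' * moment₂ e' e c' c =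
      ((Fintype.card X : ℂ) ^ 2 - 1)⁻¹ *
        ((1 - epr X) (a, a') (c, c') * (1 - epr X) (b, b') (e, e')) := by
    rw [hmoments, eq_inv_mul_iff_mul_eq₀ hd, mul_sub, moment₄_eq hX, Matrix.sub_apply,
      Matrix.sub_apply]
    ring
  have hscale : ∀ u v : ℂ, (Fintype.card X * u) * star (Fintype.card X * v) =
      (Fintype.card X : ℂ) ^ 2 * (u * star v) := fun u v => by
    rw [star_mul', star_natCast]
    ring
  simp only [centredKernel_apply, hscale]
  rw [integral_const_mul, integral_mul_star_sub_moment₂, hcov, hcoeff, div_eq_mul_inv, mul_assoc]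

end HaarMoments

section Link

variable {X Y B R : Type*} [Fintype X] [Fintype Y]

/-- The contraction of operators `τ` on `X B` and `ρ` on `Y R` along an operator `F` on `X Y`
(the link product of `F` with `τ ⊗ ρ`), as a trilinear map. With the Choi state of a channel in
place of `τ` and the Choi matrix of a unitary conjugation in place of `F`, it applies the
conjugation and then the channel to `ρ`. -/
def link : Matrix (X × B) (X × B) ℂ →ₗ[ℂ] Matrix (X × Y) (X × Y) ℂ →ₗ[ℂ]
    Matrix (Y × R) (Y × R) ℂ →ₗ[ℂ] Matrix (B × R) (B × R) ℂ :=
  LinearMap.mk₂ ℂ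
    (fun τ F =>
      { toFun := fun ρ => Matrix.of fun p q => ∑ k : X × Y, ∑ k' : X × Y,
          τ (k.1, p.1) (k'.1, q.1) * F k k' * ρ (k.2, p.2) (k'.2, q.2)
        map_add' := fun _ _ => by ext; simp [mul_add, Finset.sum_add_distrib]
        map_smul' := fun _ _ => by ext; simp [Finset.mul_sum, mul_left_comm] })
    (fun _ _ _ => by ext; simp [add_mul, Finset.sum_add_distrib])
    (fun _ _ _ => by ext; simp [Finset.mul_sum, mul_assoc])
    (fun _ _ _ => by ext; simp [mul_add, add_mul, Finset.sum_add_distrib])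
    (fun _ _ _ => by ext; simp [Finset.mul_sum, mul_left_comm, mul_assoc])

lemma link_apply (τ : Matrix (X × B) (X × B) ℂ) (F : Matrix (X × Y) (X × Y) ℂ)
    (ρ : Matrix (Y × R) (Y × R) ℂ) (p q : B × R) :
    link τ F ρ p q = ∑ k, ∑ k', τ (k.1, p.1) (k'.1, q.1) * F k k' * ρ (k.2, p.2) (k'.2, q.2) :=
  rfl

lemma conjTranspose_link (τ : Matrix (X × B) (X × B) ℂ) (F : Matrix (X × Y) (X × Y) ℂ)
    (ρ : Matrix (Y × R) (Y × R) ℂ) : (link τ F ρ)ᴴ = link τᴴ Fᴴ ρᴴ := by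
  ext p q
  simp only [link_apply, Matrix.conjTranspose_apply, star_sum, star_mul']
  rw [Finset.sum_comm]

lemma isHermitian_link {τ : Matrix (X × B) (X × B) ℂ} {F : Matrix (X × Y) (X × Y) ℂ}
    {ρ : Matrix (Y × R) (Y × R) ℂ} (hτ : τ.IsHermitian) (hF : F.IsHermitian)
    (hρ : ρ.IsHermitian) : (link τ F ρ).IsHermitian := by
  rw [Matrix.IsHermitian, conjTranspose_link, hτ.eq, hF.eq, hρ.eq]

lemma continuous_link {Ω : Type*} [TopologicalSpace Ω] (τ : Matrix (X × B) (X × B) ℂ)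
    {F : Ω → Matrix (X × Y) (X × Y) ℂ} (hF : Continuous F) (ρ : Matrix (Y × R) (Y × R) ℂ) :
    Continuous fun ω => link τ (F ω) ρ := by
  refine continuous_matrix fun p q => ?_
  simp only [link_apply]
  fun_prop

lemma link_eq_sum_link_sub (τ τ' : Matrix (X × B) (X × B) ℂ) (F : Matrix (X × Y) (X × Y) ℂ)
    (ρ ρ' : Matrix (Y × R) (Y × R) ℂ) :
    link τ F ρ = link τ F (ρ - ρ') + link (τ - τ') F ρ' + link τ' F ρ' := by
  simp only [map_sub, LinearMap.sub_apply]
  abel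

lemma link_one [DecidableEq X] [DecidableEq Y] (τ : Matrix (X × B) (X × B) ℂ)
    (ρ : Matrix (Y × R) (Y × R) ℂ) : link τ 1 ρ = traceFst τ ⊗ₖ traceFst ρ := by
  ext p q
  simp only [link_apply, Matrix.one_apply, mul_ite, mul_one, mul_zero, ite_mul, zero_mul,
    Finset.sum_ite_eq, Finset.mem_univ, if_true, Matrix.kroneckerMap_apply, traceFst,
    Matrix.of_apply, Fintype.sum_mul_sum, Fintype.sum_prod_type]

lemma link_eq_link_partialTrace {X₁ X₂ Y₁ Y₂ : Type*} [Fintype X₁] [Fintype X₂] [Fintype Y₁]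
    [Fintype Y₂] [DecidableEq X₂] [DecidableEq Y₂] (e : X₁ × X₂ ≃ X) (f : Y₁ × Y₂ ≃ Y)
    (τ : Matrix (X × B) (X × B) ℂ) {F : Matrix (X × Y) (X × Y) ℂ}
    {F₁ : Matrix (X₁ × Y₁) (X₁ × Y₁) ℂ} (ρ : Matrix (Y × R) (Y × R) ℂ)
    (hF : ∀ x x' y y', F (e x, f y) (e x', f y') =
      F₁ (x.1, y.1) (x'.1, y'.1) * (1 : Matrix (X₂ × Y₂) (X₂ × Y₂) ℂ) (x.2, y.2) (x'.2, y'.2)) :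
    link τ F ρ =
      link (Matrix.of fun p q => ∑ z, τ (e (p.1, z), p.2) (e (q.1, z), q.2)) F₁
        (Matrix.of fun p q => ∑ z, ρ (f (p.1, z), p.2) (f (q.1, z), q.2)) := by
  ext p q
  let E : (X₁ × Y₁) × (X₂ × Y₂) ≃ X × Y :=
    (Equiv.prodProdProdComm X₁ Y₁ X₂ Y₂).trans (e.prodCongr f)
  have hE : ∀ a z, E (a, z) = (e (a.1, z.1), f (a.2, z.2)) := fun _ _ => rfl
  simp only [link_apply, ← E.sum_comp, Fintype.sum_prod_type (α₁ := X₁ × Y₁), hE, hF,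
    Matrix.of_apply, Matrix.one_apply, mul_ite, mul_one, mul_zero, ite_mul, zero_mul,
    Finset.sum_ite_eq, Finset.mem_univ, if_true]
  refine Finset.sum_congr rfl fun a _ => ?_
  rw [Finset.sum_comm]
  refine Finset.sum_congr rfl fun a' _ => ?_
  rw [Fintype.sum_prod_type, Finset.sum_mul, Finset.sum_mul]
  exact Finset.sum_congr rfl fun z _ => by rw [Finset.mul_sum]

variable [Fintype B] [Fintype R]

lemma posSemidef_sum_blocks {K P : Type*} [Fintype K] [Fintype P]
    {M : Matrix (K × P) (K × P) ℂ} (hM : M.PosSemidef) :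
    (Matrix.of fun p q => ∑ k, ∑ k', M (k, p) (k', q) : Matrix P P ℂ).PosSemidef := by
  classical
  convert hM.conjTranspose_mul_mul_same
    (Matrix.of fun z q => if z.2 = q then 1 else 0 : Matrix (K × P) P ℂ) using 1
  ext p q
  simp only [Matrix.mul_apply, Matrix.conjTranspose_apply, Matrix.of_apply,
    Fintype.sum_prod_type, mul_ite, mul_one, mul_zero, Finset.sum_ite_eq', Finset.mem_univ, if_true,
    apply_ite (star : ℂ → ℂ), star_one, star_zero, ite_mul, one_mul, zero_mul]
  rw [Finset.sum_comm]

lemma posSemidef_link {τ : Matrix (X × B) (X × B) ℂ} {F : Matrix (X × Y) (X × Y) ℂ}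
    {ρ : Matrix (Y × R) (Y × R) ℂ} (hτ : τ.PosSemidef) (hF : F.PosSemidef) (hρ : ρ.PosSemidef) :
    (link τ F ρ).PosSemidef := by
  let M : Matrix ((X × Y) × (B × R)) ((X × Y) × (B × R)) ℂ :=
    ((τ ⊗ₖ F) ⊗ₖ ρ).submatrix (fun z => (((z.1.1, z.2.1), z.1), (z.1.2, z.2.2)))
      (fun z => (((z.1.1, z.2.1), z.1), (z.1.2, z.2.2)))
  have hM : M.PosSemidef := ((hτ.kronecker hF).kronecker hρ).submatrix _
  convert posSemidef_sum_blocks hM using 1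
  ext p q
  simp only [link_apply, M, Matrix.of_apply, Matrix.submatrix_apply, Matrix.kroneckerMap_apply]

lemma schattenNorm_one_link_le [DecidableEq B] [DecidableEq R]
    {τ₁ τ₂ : Matrix (X × B) (X × B) ℂ} {F₁ F₂ : Matrix (X × Y) (X × Y) ℂ}
    {ρ₁ ρ₂ : Matrix (Y × R) (Y × R) ℂ} (hτ₁ : τ₁.PosSemidef) (hτ₂ : τ₂.PosSemidef)
    (hF₁ : F₁.PosSemidef) (hF₂ : F₂.PosSemidef) (hρ₁ : ρ₁.PosSemidef) (hρ₂ : ρ₂.PosSemidef) :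
    schattenNorm 1 (link (τ₁ - τ₂) (F₁ - F₂) (ρ₁ - ρ₂)) ≤
      (link (τ₁ + τ₂) (F₁ + F₂) (ρ₁ + ρ₂)).trace.re := by
  have h := schattenNorm_one_sub_le
    ((((posSemidef_link hτ₁ hF₁ hρ₁).add (posSemidef_link hτ₁ hF₂ hρ₂)).add
      (posSemidef_link hτ₂ hF₁ hρ₂)).add (posSemidef_link hτ₂ hF₂ hρ₁))
    ((((posSemidef_link hτ₁ hF₁ hρ₂).add (posSemidef_link hτ₁ hF₂ hρ₁)).add
      (posSemidef_link hτ₂ hF₁ hρ₁)).add (posSemidef_link hτ₂ hF₂ hρ₂))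
  rw [← Complex.add_re, ← Matrix.trace_add] at h
  convert h using 3
  · simp only [map_sub, LinearMap.sub_apply]; abel
  · simp only [map_add, LinearMap.add_apply]; abel

omit [Fintype R] in
lemma trace_traceFst (τ : Matrix (X × B) (X × B) ℂ) : (traceFst τ).trace = τ.trace := by
  simp only [Matrix.trace, Matrix.diag_apply, traceFst, Matrix.of_apply,
    Fintype.sum_prod_type_right]

lemma trace_link_one [DecidableEq X] [DecidableEq Y] (τ : Matrix (X × B) (X × B) ℂ)
    (ρ : Matrix (Y × R) (Y × R) ℂ) : (link τ 1 ρ).trace = τ.trace * ρ.trace := by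
  rw [link_one, Matrix.trace_kronecker, trace_traceFst, trace_traceFst]

omit [Fintype R] in
lemma one_kronecker_mul_apply [DecidableEq X] {Z : Type*} (G : Matrix B B ℂ)
    (τ : Matrix (X × B) Z ℂ) (p : X × B) (z : Z) :
    (((1 : Matrix X X ℂ) ⊗ₖ G) * τ) p z = ∑ b, G p.2 b * τ (p.1, b) z := by
  simp [Matrix.mul_apply, Fintype.sum_prod_type, Matrix.one_apply]

lemma link_kronecker_mul [DecidableEq X] [DecidableEq Y] (τ : Matrix (X × B) (X × B) ℂ)
    (F : Matrix (X × Y) (X × Y) ℂ) (ρ : Matrix (Y × R) (Y × R) ℂ) (G : Matrix B B ℂ)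
    (H : Matrix R R ℂ) :
    link ((1 ⊗ₖ G) * τ) F ((1 ⊗ₖ H) * ρ) = (G ⊗ₖ H) * link τ F ρ := by
  ext p q
  rw [Matrix.mul_apply]
  simp only [link_apply, one_kronecker_mul_apply, Matrix.kroneckerMap_apply, Finset.mul_sum,
    Finset.sum_mul]
  conv_rhs => rw [Finset.sum_comm]
  refine Finset.sum_congr rfl fun k _ => ?_
  conv_rhs => rw [Finset.sum_comm]
  refine Finset.sum_congr rfl fun k' _ => ?_
  conv_rhs => rw [Fintype.sum_prod_type_right]
  refine Finset.sum_congr rfl fun r _ => Finset.sum_congr rfl fun b _ => ?_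
  ring

lemma link_mul_kronecker [DecidableEq X] [DecidableEq Y] (τ : Matrix (X × B) (X × B) ℂ)
    (F : Matrix (X × Y) (X × Y) ℂ) (ρ : Matrix (Y × R) (Y × R) ℂ) (G : Matrix B B ℂ)
    (H : Matrix R R ℂ) :
    link (τ * (1 ⊗ₖ G)) F (ρ * (1 ⊗ₖ H)) = link τ F ρ * (G ⊗ₖ H) := by
  apply Matrix.conjTranspose_injective
  simp only [conjTranspose_link, Matrix.conjTranspose_mul, Matrix.conjTranspose_kronecker,
    Matrix.conjTranspose_one, link_kronecker_mul]

end Link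

section ProdKernel

variable {ι : Type*} [Fintype ι] {A : ι → Type*}

/-- The tensor product of a family of operators on `A i A i`, as an operator on the product of
two copies of `∀ i, A i`. -/
def prodKernel (f : ∀ i, Matrix (A i × A i) (A i × A i) ℂ) :
    Matrix ((∀ i, A i) × (∀ i, A i)) ((∀ i, A i) × (∀ i, A i)) ℂ :=
  Matrix.of fun p q => ∏ i, f i (p.1 i, p.2 i) (q.1 i, q.2 i)

lemma prodKernel_apply (f : ∀ i, Matrix (A i × A i) (A i × A i) ℂ)
    (p q : (∀ i, A i) × (∀ i, A i)) :
    prodKernel f p q = ∏ i, f i (p.1 i, p.2 i) (q.1 i, q.2 i) := rfl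

lemma conjTranspose_prodKernel (f : ∀ i, Matrix (A i × A i) (A i × A i) ℂ) :
    (prodKernel f)ᴴ = prodKernel fun i => (f i)ᴴ := by
  ext p q
  simp only [Matrix.conjTranspose_apply, prodKernel_apply, star_prod]

lemma prodKernel_smul (c : ι → ℂ) (f : ∀ i, Matrix (A i × A i) (A i × A i) ℂ) :
    prodKernel (fun i => c i • f i) = (∏ i, c i) • prodKernel f := by
  ext p q
  simp only [prodKernel_apply, Matrix.smul_apply, smul_eq_mul, Finset.prod_mul_distrib]

lemma prodKernel_one [∀ i, DecidableEq (A i)] :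
    prodKernel (fun i => (1 : Matrix (A i × A i) (A i × A i) ℂ)) = 1 := by
  classical
  ext p q
  simp only [prodKernel_apply, Matrix.one_apply, Finset.prod_ite_zero, Finset.prod_const_one]
  refine if_congr ?_ rfl rfl
  simp [Prod.ext_iff, funext_iff, forall_and]

lemma prodKernel_piEquivPiSubtypeProd_symm (r : ι → Prop) [DecidablePred r]
    (f : ∀ i, Matrix (A i × A i) (A i × A i) ℂ)
    (x x' y y' : (∀ i : {i // r i}, A i) × (∀ i : {i // ¬r i}, A i)) :
    prodKernel f ((Equiv.piEquivPiSubtypeProd r A).symm x,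
        (Equiv.piEquivPiSubtypeProd r A).symm y)
      ((Equiv.piEquivPiSubtypeProd r A).symm x', (Equiv.piEquivPiSubtypeProd r A).symm y') =
      prodKernel (fun i : {i // r i} => f i) (x.1, y.1) (x'.1, y'.1) *
        prodKernel (fun i : {i // ¬r i} => f i) (x.2, y.2) (x'.2, y'.2) := by
  simp only [prodKernel_apply]
  rw [← Fintype.prod_subtype_mul_prod_subtype r]
  congr 1 <;> refine Finset.prod_congr rfl fun i _ => ?_
  · simp only [Equiv.piEquivPiSubtypeProd_symm_apply, dif_pos i.2]
  · simp only [Equiv.piEquivPiSubtypeProd_symm_apply, dif_neg i.2]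

variable [DecidableEq ι]

lemma prodKernel_add (f g : ∀ i, Matrix (A i × A i) (A i × A i) ℂ) :
    prodKernel (fun i => f i + g i) =
      ∑ s : Finset ι, prodKernel fun i => if i ∈ s then f i else g i := by
  ext p q
  rw [Matrix.sum_apply]
  simp only [prodKernel_apply, Matrix.add_apply]
  rw [Finset.prod_add, Finset.powerset_univ]
  refine Finset.sum_congr rfl fun s _ => ?_
  rw [← Finset.prod_mul_prod_compl s (fun i => (if i ∈ s then f i else g i) _ _),
    Finset.compl_eq_univ_sdiff]
  congr 1
  · exact Finset.prod_congr rfl fun i hi => by rw [if_pos hi]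
  · exact Finset.prod_congr rfl fun i hi => by rw [if_neg (Finset.mem_sdiff.1 hi).2]

lemma prodKernel_sub (f g : ∀ i, Matrix (A i × A i) (A i × A i) ℂ) :
    prodKernel (fun i => f i - g i) =
      ∑ s : Finset ι, (-1 : ℂ) ^ sᶜ.card • prodKernel fun i => if i ∈ s then f i else g i := by
  have hsub : (fun i => f i - g i) = fun i => f i + (-1 : ℂ) • g i := by
    ext i : 1
    rw [neg_one_smul, sub_eq_add_neg]
  rw [hsub, prodKernel_add]
  refine Finset.sum_congr rfl fun s _ => ?_
  have hsign : (fun i => if i ∈ s then f i else (-1 : ℂ) • g i) =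
      fun i => (if i ∈ s then 1 else -1 : ℂ) • (if i ∈ s then f i else g i) := by
    ext i : 1
    split_ifs <;> simp
  rw [hsign, prodKernel_smul, Finset.prod_ite, Finset.prod_const_one, one_mul, Finset.prod_const,
    ← Finset.compl_filter, Finset.filter_univ_mem]

variable [∀ i, Fintype (A i)]

lemma prodKernel_mul (f g : ∀ i, Matrix (A i × A i) (A i × A i) ℂ) :
    (prodKernel f * prodKernel g : Matrix _ _ ℂ) = prodKernel fun i => f i * g i := by
  ext p q
  simp only [Matrix.mul_apply, prodKernel_apply, Fintype.sum_prod_type,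
    ← Finset.prod_mul_distrib, Finset.prod_univ_sum, Fintype.piFinset_univ]

omit [DecidableEq ι] in
lemma posSemidef_prodKernel {f : ∀ i, Matrix (A i × A i) (A i × A i) ℂ}
    (hf : ∀ i, (f i).PosSemidef) : (prodKernel f).PosSemidef := by
  classical
  have hsq : ∀ i, ∃ V : Matrix (A i × A i) (A i × A i) ℂ, f i = Vᴴ * V := fun i => by
    open scoped MatrixOrder in
    exact CStarAlgebra.nonneg_iff_eq_star_mul_self.mp (hf i).nonneg
  choose V hV using hsq
  rw [funext hV, ← prodKernel_mul, ← conjTranspose_prodKernel]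
  exact Matrix.posSemidef_conjTranspose_mul_self _

omit [DecidableEq ι] in
lemma exists_prodKernel_sub {f g : ∀ i, Matrix (A i × A i) (A i × A i) ℂ}
    (hf : ∀ i, (f i).PosSemidef) (hg : ∀ i, (g i).PosSemidef) :
    ∃ P N : Matrix ((∀ i, A i) × (∀ i, A i)) ((∀ i, A i) × (∀ i, A i)) ℂ,
      P.PosSemidef ∧ N.PosSemidef ∧ prodKernel (fun i => f i - g i) = P - N ∧
      prodKernel (fun i => f i + g i) = P + N := by
  classical
  let K : Finset ι → Matrix ((∀ i, A i) × (∀ i, A i)) ((∀ i, A i) × (∀ i, A i)) ℂ :=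
    fun s => prodKernel fun i => if i ∈ s then f i else g i
  have hK : ∀ s, (K s).PosSemidef := fun s => posSemidef_prodKernel fun i => by
    by_cases h : i ∈ s <;> simp only [h, if_true, if_false, hf, hg]
  refine ⟨∑ s : Finset ι with Even sᶜ.card, K s, ∑ s : Finset ι with ¬ Even sᶜ.card, K s,
    Matrix.posSemidef_sum _ fun s _ => hK s, Matrix.posSemidef_sum _ fun s _ => hK s, ?_, ?_⟩
  · rw [prodKernel_sub, ← Finset.sum_filter_add_sum_filter_not _ fun s : Finset ι => Even sᶜ.card,
      sub_eq_add_neg, ← Finset.sum_neg_distrib]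
    congr 1 <;> refine Finset.sum_congr rfl fun s hs => ?_
    · rw [(Finset.mem_filter.1 hs).2.neg_one_pow, one_smul]
    · rw [(Nat.not_even_iff_odd.1 (Finset.mem_filter.1 hs).2).neg_one_pow, neg_one_smul]
  · rw [prodKernel_add, Finset.sum_filter_add_sum_filter_not]

end ProdKernel

section SecondMoment

variable {Ω J X Y B R : Type*} [Fintype J] [Fintype X] [Fintype Y] [MeasurableSpace Ω]
  {μ : Measure Ω}

lemma posSemidef_of_isStarProjection {P : Matrix J J ℂ} (hP : IsStarProjection P) :
    P.PosSemidef := by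
  have h := Matrix.posSemidef_conjTranspose_mul_self P
  rwa [← Matrix.star_eq_conjTranspose, hP.isSelfAdjoint.star_eq, hP.isIdempotentElem.eq] at h

lemma isStarProjection_kronecker {P : Matrix X X ℂ} {Q : Matrix Y Y ℂ}
    (hP : IsStarProjection P) (hQ : IsStarProjection Q) : IsStarProjection (P ⊗ₖ Q) where
  isIdempotentElem := by
    rw [IsIdempotentElem, ← Matrix.mul_kronecker_mul, hP.isIdempotentElem.eq,
      hQ.isIdempotentElem.eq]
  isSelfAdjoint := by
    rw [IsSelfAdjoint, Matrix.star_eq_conjTranspose, Matrix.conjTranspose_kronecker,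
      ← Matrix.star_eq_conjTranspose, ← Matrix.star_eq_conjTranspose, hP.isSelfAdjoint.star_eq,
      hQ.isSelfAdjoint.star_eq]

lemma dotProduct_mulVec_star_le {P : Matrix J J ℂ} (hP : IsStarProjection P) (w : J → ℂ) :
    w ⬝ᵥ P *ᵥ star w ≤ ((∑ j, ‖w j‖ ^ 2 : ℝ) : ℂ) := by
  classical
  have hnonneg := (posSemidef_of_isStarProjection hP.one_sub).dotProduct_mulVec_nonneg (star w)
  rw [star_star, Matrix.sub_mulVec, dotProduct_sub, Matrix.one_mulVec, sub_nonneg] at hnonneg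
  refine hnonneg.trans_eq ?_
  simp only [dotProduct, Pi.star_apply, RCLike.star_def, Complex.mul_conj,
    Complex.normSq_eq_norm_sq, Complex.ofReal_sum]

lemma ofReal_norm_dotProduct_sq (w v : J → ℂ) :
    ((‖w ⬝ᵥ v‖ ^ 2 : ℝ) : ℂ) = ∑ j, ∑ l, w j * star (w l) * (v j * star (v l)) := by
  rw [← Complex.normSq_eq_norm_sq, ← Complex.mul_conj, ← RCLike.star_def, dotProduct, star_sum,
    Finset.sum_mul_sum]
  refine Finset.sum_congr rfl fun j _ => Finset.sum_congr rfl fun l _ => ?_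
  rw [star_mul']
  ring

lemma integral_norm_dotProduct_sq_le {v : Ω → J → ℂ} (hv : ∀ j, MemLp (v · j) 2 μ) {c : ℝ}
    (hc : 0 ≤ c) {P : Matrix J J ℂ} (hP : IsStarProjection P)
    (hcov : ∀ j l, ∫ ω, v ω j * star (v ω l) ∂μ = c * P j l) (w : J → ℂ) :
    ∫ ω, ‖w ⬝ᵥ v ω‖ ^ 2 ∂μ ≤ c * ∑ j, ‖w j‖ ^ 2 := by
  classical
  have hint : ∀ j l, Integrable (fun ω => w j * star (w l) * (v ω j * star (v ω l))) μ :=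
    fun j l => ((hv j).integrable_mul (hv l).star).const_mul _
  have hval : ((∫ ω, ‖w ⬝ᵥ v ω‖ ^ 2 ∂μ : ℝ) : ℂ) = c * (w ⬝ᵥ P *ᵥ star w) := by
    rw [← integral_complex_ofReal]
    simp only [ofReal_norm_dotProduct_sq]
    rw [integral_finsetSum _ fun j _ => integrable_finsetSum _ fun l _ => hint j l]
    simp only [integral_finsetSum _ fun l _ => hint _ l, integral_const_mul, hcov, dotProduct,
      Matrix.mulVec, Pi.star_apply, Finset.mul_sum]
    refine Finset.sum_congr rfl fun j _ => Finset.sum_congr rfl fun l _ => ?_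
    ring
  have hle : (c : ℂ) * (w ⬝ᵥ P *ᵥ star w) ≤ c * ((∑ j, ‖w j‖ ^ 2 : ℝ) : ℂ) :=
    mul_le_mul_of_nonneg_left (dotProduct_mulVec_star_le hP w) (by exact_mod_cast hc)
  rw [← hval] at hle
  exact_mod_cast hle

lemma link_apply_eq_dotProduct (τ : Matrix (X × B) (X × B) ℂ) (F : Matrix (X × Y) (X × Y) ℂ)
    (ρ : Matrix (Y × R) (Y × R) ℂ) (p q : B × R) :
    link τ F ρ p q =
      (fun j : (X × X) × (Y × Y) =>
        τ (j.1.1, p.1) (j.1.2, q.1) * ρ (j.2.1, p.2) (j.2.2, q.2)) ⬝ᵥ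
      fun j => F (j.1.1, j.2.1) (j.1.2, j.2.2) := by
  rw [link_apply, dotProduct, ← (Equiv.prodProdProdComm X X Y Y).symm.sum_comp]
  conv_rhs => rw [Fintype.sum_prod_type]
  refine Finset.sum_congr rfl fun k _ => Finset.sum_congr rfl fun k' _ => ?_
  exact mul_right_comm _ _ _

lemma sum_pairs_comm [Fintype B] (f : X × B → X × B → ℝ) :
    ∑ i, ∑ j, f i j = ∑ b, ∑ b', ∑ a : X × X, f (a.1, b) (a.2, b') := by
  simp only [Fintype.sum_prod_type]
  rw [Finset.sum_comm]
  refine Finset.sum_congr rfl fun b _ => ?_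
  conv_rhs => rw [Finset.sum_comm]
  exact Finset.sum_congr rfl fun a _ => Finset.sum_comm

variable [DecidableEq X] [DecidableEq Y] [Fintype B] [DecidableEq B] [Fintype R] [DecidableEq R]

/- The covariance is that of the realigned matrix, with row `((x, x'), (y, y'))` for the entry
`F (x, y) (x', y')`. -/
lemma integral_schattenNorm_two_link_sq_le {F : Ω → Matrix (X × Y) (X × Y) ℂ}
    (hF : ∀ k k', MemLp (fun ω => F ω k k') 2 μ) {c : ℝ} (hc : 0 ≤ c)
    {P : Matrix ((X × X) × (Y × Y)) ((X × X) × (Y × Y)) ℂ} (hP : IsStarProjection P)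
    (hcov : ∀ j l, ∫ ω, F ω (j.1.1, j.2.1) (j.1.2, j.2.2) *
      star (F ω (l.1.1, l.2.1) (l.1.2, l.2.2)) ∂μ = c * P j l)
    (τ : Matrix (X × B) (X × B) ℂ) (ρ : Matrix (Y × R) (Y × R) ℂ) :
    ∫ ω, schattenNorm 2 (link τ (F ω) ρ) ^ 2 ∂μ ≤
      c * (schattenNorm 2 τ ^ 2 * schattenNorm 2 ρ ^ 2) := by
  have hint : ∀ p q, Integrable (fun ω => ‖link τ (F ω) ρ p q‖ ^ 2) μ := fun p q => by
    have hmem : MemLp (fun ω => link τ (F ω) ρ p q) 2 μ := by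
      simp only [link_apply_eq_dotProduct]
      exact memLp_finsetSum _ fun j _ => (hF _ _).const_mul _
    exact hmem.integrable_norm_pow two_ne_zero
  simp only [schattenNorm_two_sq_eq_sum]
  rw [integral_finsetSum _ fun p _ => integrable_finsetSum _ fun q _ => hint p q]
  simp only [integral_finsetSum _ fun q _ => hint _ q]
  calc ∑ p, ∑ q, ∫ ω, ‖link τ (F ω) ρ p q‖ ^ 2 ∂μ
      ≤ ∑ p : B × R, ∑ q : B × R, c * ((∑ a : X × X, ‖τ (a.1, p.1) (a.2, q.1)‖ ^ 2) *
          ∑ b : Y × Y, ‖ρ (b.1, p.2) (b.2, q.2)‖ ^ 2) := by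
        gcongr with p _ q _
        simp only [link_apply_eq_dotProduct]
        refine (integral_norm_dotProduct_sq_le (fun j => hF _ _) hc hP hcov _).trans_eq ?_
        rw [Finset.sum_mul_sum, Fintype.sum_prod_type]
        simp only [norm_mul, mul_pow]
    _ = _ := by
        rw [sum_pairs_comm fun i j => ‖τ i j‖ ^ 2, sum_pairs_comm fun i j => ‖ρ i j‖ ^ 2]
        simp only [Fintype.sum_prod_type (f := fun _ : B × R => _), ← Finset.mul_sum,
          ← Finset.sum_mul]

end SecondMoment

section Expectation

variable {Ω X Y B R : Type*} [Fintype X] [Fintype Y] [MeasurableSpace Ω] {μ : Measure Ω}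

lemma integral_le_sqrt_integral_sq [IsProbabilityMeasure μ] {f : Ω → ℝ} (hf : MemLp f 2 μ) :
    ∫ ω, f ω ∂μ ≤ √(∫ ω, f ω ^ 2 ∂μ) := by
  have hvar := ProbabilityTheory.variance_nonneg f μ
  rw [ProbabilityTheory.variance_eq_sub hf, sub_nonneg] at hvar
  exact Real.le_sqrt_of_sq_le hvar

lemma memLp_of_continuous {Ω E : Type*} [TopologicalSpace Ω] [CompactSpace Ω]
    [MeasurableSpace Ω] [OpensMeasurableSpace Ω] {μ : Measure Ω} [IsFiniteMeasureOnCompacts μ]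
    [NormedAddCommGroup E] {p : ℝ≥0∞} {f : Ω → E} (hf : Continuous f) : MemLp f p μ :=
  hf.memLp_of_hasCompactSupport (HasCompactSupport.of_compactSpace f)

lemma integrable_link_apply (τ : Matrix (X × B) (X × B) ℂ) {F : Ω → Matrix (X × Y) (X × Y) ℂ}
    (hF : ∀ k k', Integrable (fun ω => F ω k k') μ) (ρ : Matrix (Y × R) (Y × R) ℂ) (p q : B × R) :
    Integrable (fun ω => link τ (F ω) ρ p q) μ :=
  integrable_finsetSum _ fun k _ => integrable_finsetSum _ fun k' _ =>
    ((hF k k').const_mul _).mul_const _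

lemma integral_link_apply (τ : Matrix (X × B) (X × B) ℂ) {F : Ω → Matrix (X × Y) (X × Y) ℂ}
    (hF : ∀ k k', Integrable (fun ω => F ω k k') μ) (ρ : Matrix (Y × R) (Y × R) ℂ) (p q : B × R) :
    ∫ ω, link τ (F ω) ρ p q ∂μ = link τ (Matrix.of fun k k' => ∫ ω, F ω k k' ∂μ) ρ p q := by
  have hint : ∀ k k', Integrable
      (fun ω => τ (k.1, p.1) (k'.1, q.1) * F ω k k' * ρ (k.2, p.2) (k'.2, q.2)) μ :=
    fun k k' => ((hF k k').const_mul _).mul_const _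
  simp only [link_apply]
  rw [integral_finsetSum _ fun k _ => integrable_finsetSum _ fun k' _ => hint k k']
  simp only [integral_finsetSum _ fun k' _ => hint _ k', integral_const_mul, integral_mul_const,
    Matrix.of_apply]

lemma integral_re_trace_link [Fintype B] [Fintype R] (τ : Matrix (X × B) (X × B) ℂ)
    {F : Ω → Matrix (X × Y) (X × Y) ℂ} (hF : ∀ k k', Integrable (fun ω => F ω k k') μ)
    (ρ : Matrix (Y × R) (Y × R) ℂ) :
    ∫ ω, (link τ (F ω) ρ).trace.re ∂μ =
      (link τ (Matrix.of fun k k' => ∫ ω, F ω k k' ∂μ) ρ).trace.re := by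
  have hint := integrable_link_apply τ hF ρ
  have hre : ∫ ω, (link τ (F ω) ρ).trace.re ∂μ = (∫ ω, (link τ (F ω) ρ).trace ∂μ).re :=
    Complex.reCLM.integral_comp_comm (integrable_finsetSum _ fun p _ => hint p p)
  rw [hre]
  simp only [Matrix.trace, Matrix.diag_apply]
  rw [integral_finsetSum _ fun p _ => hint p p]
  simp only [integral_link_apply τ hF ρ]

end Expectation

section PiHaar

lemma isStarProjection_epr (X : Type*) [Fintype X] [DecidableEq X] :
    IsStarProjection (epr X) where
  isIdempotentElem := by
    ext p q
    have hcard : p.1 = p.2 → (Fintype.card X : ℂ) ≠ 0 := fun _ =>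
      haveI : Nonempty X := ⟨p.1⟩
      Nat.cast_ne_zero.2 Fintype.card_ne_zero
    simp only [epr, Matrix.mul_apply, Matrix.of_apply, Fintype.sum_prod_type]
    by_cases hp : p.1 = p.2 <;> by_cases hq : q.1 = q.2 <;> simp [hp, hq, hcard]
  isSelfAdjoint := by
    ext p q
    simp only [epr, Matrix.star_apply, Matrix.of_apply, and_comm]
    split_ifs <;> simp

variable {ι : Type*} [Fintype ι] {A : ι → Type*} [∀ i, Fintype (A i)] [∀ i, DecidableEq (A i)]

omit [∀ i, DecidableEq (A i)] in
lemma isStarProjection_prodKernel [DecidableEq ι] {f : ∀ i, Matrix (A i × A i) (A i × A i) ℂ}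
    (hf : ∀ i, IsStarProjection (f i)) : IsStarProjection (prodKernel f) := by
  refine ⟨?_, ?_⟩
  · simp only [IsIdempotentElem, prodKernel_mul, (hf _).isIdempotentElem.eq]
  · simp only [IsSelfAdjoint, Matrix.star_eq_conjTranspose, conjTranspose_prodKernel]
    simp only [← Matrix.star_eq_conjTranspose, (hf _).isSelfAdjoint.star_eq]

/-- The law of independent Haar random unitaries `U i` on the systems `A i`. -/
abbrev piHaar (A : ι → Type*) [∀ i, Fintype (A i)] [∀ i, DecidableEq (A i)] :
    Measure (∀ i, Matrix.unitaryGroup (A i) ℂ) :=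
  Measure.pi fun i => haarUnitary (A i)

lemma integral_prodKernel_apply {f : ∀ i, Matrix.unitaryGroup (A i) ℂ →
      Matrix (A i × A i) (A i × A i) ℂ} (k k' : (∀ i, A i) × (∀ i, A i)) :
    ∫ U, prodKernel (fun i => f i (U i)) k k' ∂piHaar A =
      prodKernel (fun i => Matrix.of fun a a' => ∫ u, f i u a a' ∂haarUnitary (A i)) k k' :=
  integral_fintype_prod_eq_prod fun i u => f i u (k.1 i, k.2 i) (k'.1 i, k'.2 i)

/-- The tensor product of the centred kernels of a family of unitaries. -/
def centredProd (U : ∀ i, Matrix.unitaryGroup (A i) ℂ) :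
    Matrix ((∀ i, A i) × (∀ i, A i)) ((∀ i, A i) × (∀ i, A i)) ℂ :=
  prodKernel fun i => centredKernel (U i).1

/-- The tensor product of the sums of the kernels of the unitaries and their means: it dominates
`centredProd` as `P + N` dominates `P - N`. -/
def absProd (U : ∀ i, Matrix.unitaryGroup (A i) ℂ) :
    Matrix ((∀ i, A i) × (∀ i, A i)) ((∀ i, A i) × (∀ i, A i)) ℂ :=
  prodKernel fun i => conjKernel (U i).1 + 1

lemma posSemidef_conjKernel {X : Type*} [Fintype X] (U : Matrix X X ℂ) :
    (conjKernel U).PosSemidef :=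
  (Matrix.posSemidef_vecMulVec_self_star fun p : X × X => U p.1 p.2).smul (Nat.cast_nonneg _)

lemma exists_centredProd_eq_sub (U : ∀ i, Matrix.unitaryGroup (A i) ℂ) :
    ∃ P N, P.PosSemidef ∧ N.PosSemidef ∧ centredProd U = P - N ∧ absProd U = P + N := by
  classical
  exact exists_prodKernel_sub (fun _ => posSemidef_conjKernel _) fun _ => Matrix.PosSemidef.one

lemma isHermitian_centredProd (U : ∀ i, Matrix.unitaryGroup (A i) ℂ) :
    (centredProd U).IsHermitian := by
  obtain ⟨P, N, hP, hN, hPN, -⟩ := exists_centredProd_eq_sub U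
  rw [hPN]
  exact hP.isHermitian.sub hN.isHermitian

omit [∀ i, Fintype (A i)] [∀ i, DecidableEq (A i)] in
lemma continuous_prodKernel {Ω : Type*} [TopologicalSpace Ω]
    {f : Ω → ∀ i, Matrix (A i × A i) (A i × A i) ℂ} (hf : ∀ i, Continuous fun ω => f ω i) :
    Continuous fun ω => prodKernel (f ω) :=
  continuous_matrix fun _ _ => continuous_finsetProd _ fun i _ => (hf i).matrix_elem _ _

lemma continuous_conjKernel {X : Type*} [Fintype X] [DecidableEq X] :
    Continuous fun U : Matrix.unitaryGroup X ℂ => conjKernel U.1 :=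
  continuous_matrix fun p q => continuous_const.mul <|
    (continuous_unitary_apply p.1 p.2).mul (continuous_unitary_apply q.1 q.2).star

lemma continuous_centredProd :
    Continuous fun U : ∀ i, Matrix.unitaryGroup (A i) ℂ => centredProd U :=
  continuous_prodKernel fun i =>
    (continuous_conjKernel.comp (continuous_apply i)).sub continuous_const

lemma continuous_absProd : Continuous fun U : ∀ i, Matrix.unitaryGroup (A i) ℂ => absProd U :=
  continuous_prodKernel fun i =>
    (continuous_conjKernel.comp (continuous_apply i)).add continuous_const

lemma integral_conjKernel_add_one {X : Type*} [Fintype X] [DecidableEq X] (p q : X × X) :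
    ∫ U : Matrix.unitaryGroup X ℂ, (conjKernel U.1 + 1) p q ∂haarUnitary X =
      ((2 : ℂ) • (1 : Matrix (X × X) (X × X) ℂ)) p q := by
  have hmean : ∫ U : Matrix.unitaryGroup X ℂ, conjKernel U.1 p q ∂haarUnitary X =
      (1 : Matrix (X × X) (X × X) ℂ) p q :=
    (integral_const_mul _ _).trans (one_apply_eq_card_mul_moment₂ _ _ _ _).symm
  simp only [Matrix.add_apply]
  rw [integral_add (integrable_of_continuous (continuous_conjKernel.matrix_elem _ _))
    (integrable_const _), hmean, integral_const, probReal_univ, one_smul, Matrix.smul_apply,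
    smul_eq_mul, two_mul]

lemma integral_absProd (k k' : (∀ i, A i) × (∀ i, A i)) :
    ∫ U, absProd U k k' ∂piHaar A = ((2 : ℂ) ^ Fintype.card ι • (1 : Matrix _ _ ℂ)) k k' := by
  simp only [absProd]
  rw [integral_prodKernel_apply (f := fun i u => conjKernel u.1 + 1)]
  simp only [integral_conjKernel_add_one]
  rw [← prodKernel_one, ← Finset.card_univ, ← Finset.prod_const, ← prodKernel_smul]
  rfl

lemma integral_centredProd_mul_star (hA : ∀ i, 2 ≤ Fintype.card (A i))
    (j l : ((∀ i, A i) × (∀ i, A i)) × ((∀ i, A i) × (∀ i, A i))) :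
    ∫ U, centredProd U (j.1.1, j.2.1) (j.1.2, j.2.2) *
        star (centredProd U (l.1.1, l.2.1) (l.1.2, l.2.2)) ∂piHaar A =
      ((∏ i, (1 - ((Fintype.card (A i) : ℝ) ^ 2)⁻¹)⁻¹ : ℝ) : ℂ) *
        (prodKernel (fun i => 1 - epr (A i)) ⊗ₖ prodKernel fun i => 1 - epr (A i)) j l := by
  simp only [centredProd, prodKernel_apply, star_prod, ← Finset.prod_mul_distrib,
    Matrix.kroneckerMap_apply]
  refine (integral_fintype_prod_eq_prod fun i (u : Matrix.unitaryGroup (A i) ℂ) =>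
    centredKernel u.1 (j.1.1 i, j.2.1 i) (j.1.2 i, j.2.2 i) *
      star (centredKernel u.1 (l.1.1 i, l.2.1 i) (l.1.2 i, l.2.2 i))).trans ?_
  simp only [integral_centredKernel_mul_star (hA _), Finset.prod_mul_distrib, Complex.ofReal_prod]
  push_cast
  rfl

end PiHaar

section CentredProd

variable {ι : Type*} [Fintype ι] [DecidableEq ι] {A : ι → Type*} [∀ i, Fintype (A i)]
  [∀ i, DecidableEq (A i)] {B R : Type*} [Fintype B] [DecidableEq B] [Fintype R] [DecidableEq R]

omit [DecidableEq B] [DecidableEq R] in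
lemma integral_re_trace_link_absProd (τ : Matrix ((∀ i, A i) × B) ((∀ i, A i) × B) ℂ)
    {ρ : Matrix ((∀ i, A i) × R) ((∀ i, A i) × R) ℂ} (hρ : ρ.PosSemidef) :
    ∫ U, (link τ (absProd U) ρ).trace.re ∂piHaar A =
      2 ^ Fintype.card ι * (τ.trace.re * ρ.trace.re) := by
  have hint : ∀ k k', Integrable (fun U => absProd U k k') (piHaar A) := fun k k' =>
    integrable_of_continuous (continuous_absProd.matrix_elem k k')
  have hmean : (Matrix.of fun k k' => ∫ U, absProd U k k' ∂piHaar A) =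
      ((2 ^ Fintype.card ι : ℝ) : ℂ) • (1 : Matrix _ _ ℂ) := by
    ext k k'
    rw [Matrix.of_apply, integral_absProd]
    push_cast
    rfl
  have hρim : ρ.trace.im = 0 := (Complex.nonneg_iff.1 hρ.trace_nonneg).2.symm
  rw [integral_re_trace_link τ hint ρ, hmean, map_smul, LinearMap.smul_apply, Matrix.trace_smul,
    trace_link_one, smul_eq_mul, Complex.re_ofReal_mul, Complex.mul_re, hρim, mul_zero, sub_zero]

lemma continuous_schattenNorm_one_link_centredProd
    {τ : Matrix ((∀ i, A i) × B) ((∀ i, A i) × B) ℂ}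
    {ρ : Matrix ((∀ i, A i) × R) ((∀ i, A i) × R) ℂ} (hτ : τ.IsHermitian) (hρ : ρ.IsHermitian) :
    Continuous fun U : ∀ i, Matrix.unitaryGroup (A i) ℂ =>
      schattenNorm 1 (link τ (centredProd U) ρ) :=
  continuous_schattenNorm_one (continuous_link τ continuous_centredProd ρ) fun U =>
    isHermitian_link hτ (isHermitian_centredProd U) hρ

lemma integral_schattenNorm_one_link_centredProd_le
    {τ : Matrix ((∀ i, A i) × B) ((∀ i, A i) × B) ℂ}
    {ρ : Matrix ((∀ i, A i) × R) ((∀ i, A i) × R) ℂ} (hτ : τ.IsHermitian) (hρ : ρ.IsHermitian) :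
    ∫ U, schattenNorm 1 (link τ (centredProd U) ρ) ∂piHaar A ≤
      2 ^ Fintype.card ι * (schattenNorm 1 τ * schattenNorm 1 ρ) := by
  have hcont := continuous_schattenNorm_one_link_centredProd hτ hρ
  obtain ⟨τ₁, τ₂, hτ₁, hτ₂, rfl, hτnorm⟩ := exists_jordanDecomposition hτ
  obtain ⟨ρ₁, ρ₂, hρ₁, hρ₂, rfl, hρnorm⟩ := exists_jordanDecomposition hρ
  have hcont' : Continuous fun U : ∀ i, Matrix.unitaryGroup (A i) ℂ =>
      (link (τ₁ + τ₂) (absProd U) (ρ₁ + ρ₂)).trace.re :=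
    Complex.continuous_re.comp (continuous_link _ continuous_absProd _).matrix_trace
  have hle : ∀ U : ∀ i, Matrix.unitaryGroup (A i) ℂ,
      schattenNorm 1 (link (τ₁ - τ₂) (centredProd U) (ρ₁ - ρ₂)) ≤
        (link (τ₁ + τ₂) (absProd U) (ρ₁ + ρ₂)).trace.re := fun U => by
    obtain ⟨P, N, hP, hN, hsub, hadd⟩ := exists_centredProd_eq_sub U
    rw [hsub, hadd]
    exact schattenNorm_one_link_le hτ₁ hτ₂ hP hN hρ₁ hρ₂
  refine (integral_mono (integrable_of_continuous hcont) (integrable_of_continuous hcont')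
    hle).trans_eq ?_
  rw [integral_re_trace_link_absProd _ (hρ₁.add hρ₂), hτnorm, hρnorm, Matrix.trace_add,
    Matrix.trace_add, Complex.add_re, Complex.add_re]

lemma integral_schattenNorm_two_link_centredProd_le (hA : ∀ i, 2 ≤ Fintype.card (A i))
    (τ : Matrix ((∀ i, A i) × B) ((∀ i, A i) × B) ℂ)
    (ρ : Matrix ((∀ i, A i) × R) ((∀ i, A i) × R) ℂ) :
    ∫ U, schattenNorm 2 (link τ (centredProd U) ρ) ∂piHaar A ≤
      (∏ i, (1 - ((Fintype.card (A i) : ℝ) ^ 2)⁻¹) ^ (-1 / 2 : ℝ)) *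
        (schattenNorm 2 τ * schattenNorm 2 ρ) := by
  have hd : ∀ i, 0 ≤ 1 - ((Fintype.card (A i) : ℝ) ^ 2)⁻¹ := fun i => sub_nonneg.2 <|
    inv_le_one_of_one_le₀ <| one_le_pow₀ <| by exact_mod_cast one_le_two.trans (hA i)
  have hc : 0 ≤ ∏ i, (1 - ((Fintype.card (A i) : ℝ) ^ 2)⁻¹)⁻¹ :=
    Finset.prod_nonneg fun i _ => inv_nonneg.2 (hd i)
  have hproj : IsStarProjection (prodKernel fun i => 1 - epr (A i)) :=
    isStarProjection_prodKernel fun i => (isStarProjection_epr (A i)).one_sub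
  have hsq := integral_schattenNorm_two_link_sq_le (μ := piHaar A) (F := centredProd)
    (fun k k' => memLp_of_continuous (continuous_centredProd.matrix_elem k k')) hc
    (isStarProjection_kronecker hproj hproj) (integral_centredProd_mul_star hA) τ ρ
  have hcont : Continuous fun U : ∀ i, Matrix.unitaryGroup (A i) ℂ =>
      schattenNorm 2 (link τ (centredProd U) ρ) :=
    continuous_schattenNorm_two.comp (continuous_link τ continuous_centredProd ρ)
  have hsqrt : √(∏ i, (1 - ((Fintype.card (A i) : ℝ) ^ 2)⁻¹)⁻¹) =
      ∏ i, (1 - ((Fintype.card (A i) : ℝ) ^ 2)⁻¹) ^ (-1 / 2 : ℝ) := by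
    rw [Real.sqrt_eq_rpow, ← Real.finsetProd_rpow _ _ fun i _ => inv_nonneg.2 (hd i)]
    refine Finset.prod_congr rfl fun i _ => ?_
    rw [neg_div, Real.rpow_neg (hd i), Real.inv_rpow (hd i)]
  refine (integral_le_sqrt_integral_sq (memLp_of_continuous hcont)).trans
    ((Real.sqrt_le_sqrt hsq).trans_eq ?_)
  rw [Real.sqrt_mul hc, ← mul_pow, hsqrt, Real.sqrt_sq
    (mul_nonneg (schattenNorm_two_nonneg _) (schattenNorm_two_nonneg _))]

end CentredProd

section Weight

variable {X Y B R : Type*} [Fintype X] [DecidableEq X] [Fintype Y] [DecidableEq Y] [Fintype B]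
  [DecidableEq B] [Fintype R] [DecidableEq R]

/-- `M` is a Hermitian operator whose Hilbert–Schmidt norm is at most `x` after removing a weight
`G` on the second system, normalised by `Tr G⁴ ≤ 1`. The weight `G = β^{1/4}` turns a bound on the
Rényi-2 divergence relative to `1 ⊗ β` into this form. -/
def HasWeight (M : Matrix (X × B) (X × B) ℂ) (x : ℝ) : Prop :=
  ∃ (G : Matrix B B ℂ) (N : Matrix (X × B) (X × B) ℂ), G.IsHermitian ∧ N.IsHermitian ∧
    (G * G * (G * G)).trace.re ≤ 1 ∧ schattenNorm 2 N ≤ x ∧ M = (1 ⊗ₖ G) * N * (1 ⊗ₖ G)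

lemma HasWeight.isHermitian {M : Matrix (X × B) (X × B) ℂ} {x : ℝ} (hM : HasWeight M x) :
    M.IsHermitian := by
  obtain ⟨G, N, hG, hN, -, -, rfl⟩ := hM
  have hGH : ((1 : Matrix X X ℂ) ⊗ₖ G)ᴴ = 1 ⊗ₖ G := by
    rw [Matrix.conjTranspose_kronecker, Matrix.conjTranspose_one, hG.eq]
  have hconj := Matrix.isHermitian_conjTranspose_mul_mul ((1 : Matrix X X ℂ) ⊗ₖ G) hN
  rwa [hGH] at hconj

omit [DecidableEq B] in
lemma trace_mul_self_mul_self_nonneg {G : Matrix B B ℂ} (hG : G.IsHermitian) :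
    0 ≤ (G * G * (G * G)).trace := by
  have hpos := (Matrix.posSemidef_conjTranspose_mul_self (G * G)).trace_nonneg
  rwa [Matrix.conjTranspose_mul, hG.eq] at hpos

omit [DecidableEq B] [DecidableEq R] in
lemma trace_kronecker_pow_four_re_le_one {G : Matrix B B ℂ} {H : Matrix R R ℂ}
    (hG : G.IsHermitian) (hH : H.IsHermitian) (hG4 : (G * G * (G * G)).trace.re ≤ 1)
    (hH4 : (H * H * (H * H)).trace.re ≤ 1) :
    ((G ⊗ₖ H) * (G ⊗ₖ H) * ((G ⊗ₖ H) * (G ⊗ₖ H))).trace.re ≤ 1 := by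
  have hGtr := Complex.nonneg_iff.1 (trace_mul_self_mul_self_nonneg hG)
  have hHtr := Complex.nonneg_iff.1 (trace_mul_self_mul_self_nonneg hH)
  simp only [← Matrix.mul_kronecker_mul, Matrix.trace_kronecker]
  rw [Complex.mul_re, ← hGtr.2, zero_mul, sub_zero]
  exact mul_le_one₀ hG4 hHtr.1 hH4

lemma schattenNorm_one_link_conj_le {F : Matrix (X × Y) (X × Y) ℂ} (hF : F.IsHermitian)
    {G : Matrix B B ℂ} {H : Matrix R R ℂ} {τ : Matrix (X × B) (X × B) ℂ}
    {ρ : Matrix (Y × R) (Y × R) ℂ} (hG : G.IsHermitian) (hH : H.IsHermitian)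
    (hτ : τ.IsHermitian) (hρ : ρ.IsHermitian) (hG4 : (G * G * (G * G)).trace.re ≤ 1)
    (hH4 : (H * H * (H * H)).trace.re ≤ 1) :
    schattenNorm 1 (link ((1 ⊗ₖ G) * τ * (1 ⊗ₖ G)) F ((1 ⊗ₖ H) * ρ * (1 ⊗ₖ H))) ≤
      schattenNorm 2 (link τ F ρ) := by
  have hGH : (G ⊗ₖ H).IsHermitian := by
    rw [Matrix.IsHermitian, Matrix.conjTranspose_kronecker, hG.eq, hH.eq]
  have hsqrt := Real.sqrt_le_one.2 (trace_kronecker_pow_four_re_le_one hG hH hG4 hH4)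
  rw [link_mul_kronecker, link_kronecker_mul]
  exact (schattenNorm_one_conj_le hGH (isHermitian_link hτ hF hρ)).trans
    (mul_le_of_le_one_left (schattenNorm_two_nonneg _) hsqrt)

end Weight

section Smoothing

variable {ι : Type*} [Fintype ι] [DecidableEq ι] {A : ι → Type*} [∀ i, Fintype (A i)]
  [∀ i, DecidableEq (A i)] {B R : Type*} [Fintype B] [DecidableEq B] [Fintype R] [DecidableEq R]
  {τ τ' : Matrix ((∀ i, A i) × B) ((∀ i, A i) × B) ℂ}
  {ρ ρ' : Matrix ((∀ i, A i) × R) ((∀ i, A i) × R) ℂ}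

omit [DecidableEq ι] [∀ i, DecidableEq (A i)] in
lemma prod_one_sub_inv_sq_rpow_nonneg :
    0 ≤ ∏ i, (1 - ((Fintype.card (A i) : ℝ) ^ 2)⁻¹) ^ (-1 / 2 : ℝ) := by
  refine Finset.prod_nonneg fun i _ => Real.rpow_nonneg (sub_nonneg.2 ?_) _
  rw [← Nat.cast_pow]
  exact Nat.cast_inv_le_one _

lemma integral_schattenNorm_one_link_centredProd_le_of_hasWeight
    (hA : ∀ i, 2 ≤ Fintype.card (A i)) {x y : ℝ} (hx : HasWeight ρ x) (hy : HasWeight τ y) :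
    ∫ U, schattenNorm 1 (link τ (centredProd U) ρ) ∂piHaar A ≤
      (∏ i, (1 - ((Fintype.card (A i) : ℝ) ^ 2)⁻¹) ^ (-1 / 2 : ℝ)) * (x * y) := by
  have hcont₁ := continuous_schattenNorm_one_link_centredProd hy.isHermitian hx.isHermitian
  obtain ⟨H, ρ₀, hH, hρ₀, hH4, hρx, rfl⟩ := hx
  obtain ⟨G, τ₀, hG, hτ₀, hG4, hτy, rfl⟩ := hy
  have hle : ∀ U : ∀ i, Matrix.unitaryGroup (A i) ℂ, _ := fun U =>
    schattenNorm_one_link_conj_le (isHermitian_centredProd U) hG hH hτ₀ hρ₀ hG4 hH4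
  have hcont₂ : Continuous fun U : ∀ i, Matrix.unitaryGroup (A i) ℂ =>
      schattenNorm 2 (link τ₀ (centredProd U) ρ₀) :=
    continuous_schattenNorm_two.comp (continuous_link _ continuous_centredProd _)
  have hy₀ := (schattenNorm_two_nonneg τ₀).trans hτy
  rw [mul_comm x]
  calc
    _ ≤ ∫ U, schattenNorm 2 (link τ₀ (centredProd U) ρ₀) ∂piHaar A :=
      integral_mono (integrable_of_continuous hcont₁) (integrable_of_continuous hcont₂) hle
    _ ≤ _ := integral_schattenNorm_two_link_centredProd_le hA τ₀ ρ₀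
    _ ≤ _ := mul_le_mul_of_nonneg_left (mul_le_mul hτy hρx (schattenNorm_two_nonneg _) hy₀)
      prod_one_sub_inv_sq_rpow_nonneg

lemma integral_schattenNorm_one_link_centredProd_le_add_add (hτ : τ.IsHermitian)
    (hτ' : τ'.IsHermitian) (hρ : ρ.IsHermitian) (hρ' : ρ'.IsHermitian) :
    ∫ U, schattenNorm 1 (link τ (centredProd U) ρ) ∂piHaar A ≤
      ∫ U, schattenNorm 1 (link τ (centredProd U) (ρ - ρ')) ∂piHaar A +
        ∫ U, schattenNorm 1 (link (τ - τ') (centredProd U) ρ') ∂piHaar A +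
        ∫ U, schattenNorm 1 (link τ' (centredProd U) ρ') ∂piHaar A := by
  have hint : ∀ {M : Matrix ((∀ i, A i) × B) ((∀ i, A i) × B) ℂ}
      {N : Matrix ((∀ i, A i) × R) ((∀ i, A i) × R) ℂ}, M.IsHermitian → N.IsHermitian →
      Integrable (fun U => schattenNorm 1 (link M (centredProd U) N)) (piHaar A) :=
    fun hM hN => integrable_of_continuous (continuous_schattenNorm_one_link_centredProd hM hN)
  have hint₁ := hint hτ (hρ.sub hρ')
  have hint₂ := hint (hτ.sub hτ') hρ'
  have hint₃ := hint hτ' hρ'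
  rw [← integral_add' hint₁ hint₂, ← integral_add' (hint₁.add hint₂) hint₃]
  refine integral_mono (hint hτ hρ) ((hint₁.add hint₂).add hint₃) fun U => ?_
  have hU := isHermitian_centredProd U
  have h₁ := isHermitian_link hτ hU (hρ.sub hρ')
  have h₂ := isHermitian_link (hτ.sub hτ') hU hρ'
  simp only [Pi.add_apply]
  rw [link_eq_sum_link_sub τ τ' _ ρ ρ']
  grw [schattenNorm_one_add_le (h₁.add h₂) (isHermitian_link hτ' hU hρ'),
    schattenNorm_one_add_le h₁ h₂]

lemma integral_schattenNorm_one_link_centredProd_le_of_near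
    (hA : ∀ i, 2 ≤ Fintype.card (A i)) (hτ : IsSubnormalised τ) (hρ : ρ.IsHermitian)
    (hρ' : IsSubnormalised ρ') {ε : ℝ} (hτε : schattenNorm 1 (τ' - τ) ≤ ε)
    (hρε : schattenNorm 1 (ρ' - ρ) ≤ ε) {x y : ℝ} (hx : HasWeight ρ' x) (hy : HasWeight τ' y) :
    ∫ U, schattenNorm 1 (link τ (centredProd U) ρ) ∂piHaar A ≤
      2 * 2 ^ Fintype.card ι * ε +
        (∏ i, (1 - ((Fintype.card (A i) : ℝ) ^ 2)⁻¹) ^ (-1 / 2 : ℝ)) * (x * y) := by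
  have hτH := hτ.1.isHermitian
  have hρH' := hρ'.1.isHermitian
  have hρsmall : schattenNorm 1 τ * schattenNorm 1 (ρ - ρ') ≤ ε := by
    rw [schattenNorm_sub_comm]
    exact (mul_le_of_le_one_left (schattenNorm_one_nonneg (hρH'.sub hρ))
      hτ.schattenNorm_one_le).trans hρε
  have hτsmall : schattenNorm 1 (τ - τ') * schattenNorm 1 ρ' ≤ ε := by
    rw [schattenNorm_sub_comm]
    exact (mul_le_of_le_one_right (schattenNorm_one_nonneg (hy.isHermitian.sub hτH))
      hρ'.schattenNorm_one_le).trans hτε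
  grw [integral_schattenNorm_one_link_centredProd_le_add_add hτH hy.isHermitian hρ hρH',
    integral_schattenNorm_one_link_centredProd_le hτH (hρ.sub hρH'),
    integral_schattenNorm_one_link_centredProd_le (hτH.sub hy.isHermitian) hρH', hρsmall, hτsmall,
    integral_schattenNorm_one_link_centredProd_le_of_hasWeight hA hx hy]
  exact (by ring : _ = _).le

end Smoothing

section SuppPow

variable {X : Type*} [Fintype X] [DecidableEq X] {α β : Matrix X X ℂ}

open scoped MatrixOrder in
lemma suppPow_mul_suppPow (hβ : β.PosSemidef) (s t : ℝ) :
    suppPow β s * suppPow β t = suppPow β (s + t) := by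
  rw [suppPow, suppPow, suppPow, ← cfc_mul_matrix]
  refine cfc_congr fun x hx => ?_
  rcases (spectrum_nonneg_of_nonneg hβ.nonneg hx).eq_or_lt with rfl | hpos
  · simp
  · simp only [hpos.ne', if_false, Real.rpow_add hpos]

lemma suppPow_one (hβ : β.IsHermitian) : suppPow β 1 = β := by
  have hid : (fun x : ℝ => if x = 0 then 0 else x ^ (1 : ℝ)) = fun x => x := by
    ext x
    split_ifs with h <;> simp [h]
  rw [suppPow, hid, cfc_id' ℝ β hβ.isSelfAdjoint]

lemma isHermitian_suppPow (β : Matrix X X ℂ) (s : ℝ) : (suppPow β s).IsHermitian :=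
  cfc_predicate _ β

lemma suppPow_zero_mul_self (hβ : β.PosSemidef) : suppPow β 0 * β = β := by
  simpa only [suppPow_one hβ.isHermitian, zero_add] using suppPow_mul_suppPow hβ 0 1

lemma mul_suppPow_zero_eq_self_iff (hα : α.IsHermitian) :
    α * suppPow β 0 = α ↔ suppPow β 0 * α = α := by
  rw [← Matrix.conjTranspose_inj, Matrix.conjTranspose_mul, hα.eq, (isHermitian_suppPow β 0).eq]

lemma supp_le_iff_suppPow_zero_mul (hβ : β.PosSemidef) :
    supp α ≤ supp β ↔ suppPow β 0 * α = α := by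
  constructor
  · intro h
    refine Matrix.mulVec_injective (funext fun v => ?_)
    obtain ⟨u, hu⟩ := h ⟨v, rfl⟩
    simp only [Matrix.mulVecLin_apply] at hu
    rw [← Matrix.mulVec_mulVec, ← hu, Matrix.mulVec_mulVec, suppPow_zero_mul_self hβ]
  · rintro h _ ⟨v, rfl⟩
    have hinv : β * suppPow β (-1) = suppPow β 0 := by
      simpa only [suppPow_one hβ.isHermitian, add_neg_cancel] using suppPow_mul_suppPow hβ 1 (-1)
    refine ⟨(suppPow β (-1) * α).mulVec v, ?_⟩
    rw [Matrix.mulVecLin_apply, Matrix.mulVecLin_apply, Matrix.mulVec_mulVec, ← mul_assoc, hinv, h]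

omit [DecidableEq X] in
lemma supp_le_of_ker_le (hα : α.IsHermitian) (hβ : β.PosSemidef)
    (h : ∀ v, β.mulVec v = 0 → α.mulVec v = 0) : supp α ≤ supp β := by
  classical
  have hβ₀ : β * suppPow β 0 = β :=
    (mul_suppPow_zero_eq_self_iff hβ.isHermitian).2 (suppPow_zero_mul_self hβ)
  rw [supp_le_iff_suppPow_zero_mul hβ, ← mul_suppPow_zero_eq_self_iff hα]
  refine Matrix.mulVec_injective (funext fun v => ?_)
  have hker := h (v - (suppPow β 0).mulVec v) (by
    rw [Matrix.mulVec_sub, Matrix.mulVec_mulVec, hβ₀, sub_self])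
  rw [Matrix.mulVec_sub, Matrix.mulVec_mulVec, sub_eq_zero] at hker
  exact hker.symm

lemma suppPow_conj_suppPow_neg_conj (hα : α.IsHermitian) (hβ : β.PosSemidef)
    (h : supp α ≤ supp β) (s : ℝ) :
    suppPow β s * (suppPow β (-s) * α * suppPow β (-s)) * suppPow β s = α := by
  have hleft := (supp_le_iff_suppPow_zero_mul hβ).1 h
  have hright := (mul_suppPow_zero_eq_self_iff hα).2 hleft
  calc
    _ = suppPow β s * suppPow β (-s) * α * (suppPow β (-s) * suppPow β s) := by
      simp only [mul_assoc]
    _ = α := by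
      rw [suppPow_mul_suppPow hβ, suppPow_mul_suppPow hβ, add_neg_cancel, neg_add_cancel, hleft,
        hright]

/-- The embedding `M ↦ 1 ⊗ M`, as a star algebra homomorphism, so that it commutes with the
functional calculus. -/
def oneKronecker (X Y : Type*) [Fintype X] [DecidableEq X] [Fintype Y] [DecidableEq Y] :
    Matrix Y Y ℂ →⋆ₐ[ℝ] Matrix (X × Y) (X × Y) ℂ where
  toFun M := 1 ⊗ₖ M
  map_one' := Matrix.one_kronecker_one
  map_mul' M N := by rw [← Matrix.mul_kronecker_mul, one_mul]
  map_zero' := Matrix.kronecker_zero _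
  map_add' M N := Matrix.kronecker_add _ _ _
  commutes' r := by
    rw [Algebra.algebraMap_eq_smul_one, Algebra.algebraMap_eq_smul_one, Matrix.kronecker_smul,
      Matrix.one_kronecker_one]
  map_star' M := by
    simp only [Matrix.star_eq_conjTranspose, Matrix.conjTranspose_kronecker,
      Matrix.conjTranspose_one]

lemma suppPow_one_kronecker {Y : Type*} [Fintype Y] [DecidableEq Y] {ζ : Matrix Y Y ℂ}
    (hζ : ζ.IsHermitian) (s : ℝ) :
    suppPow ((1 : Matrix X X ℂ) ⊗ₖ ζ) s = 1 ⊗ₖ suppPow ζ s := by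
  have hcont : Continuous (oneKronecker X Y) := continuous_matrix fun p q =>
    continuous_const.mul (continuous_id.matrix_elem p.2 q.2)
  exact ((oneKronecker X Y).map_cfc _ ζ (continuousOn_spectrum _ ζ) hcont hζ.isSelfAdjoint
    (hζ.isSelfAdjoint.map (oneKronecker X Y))).symm

end SuppPow

section Renyi

variable {X Y : Type*} [Fintype X] [Fintype Y]

lemma le_rpow_of_two_mul_elog2_lt {r x : ℝ} (h : 2 * elog2 r < (x : EReal)) :
    r ≤ (2 : ℝ) ^ (x / 2) := by
  rcases le_or_gt r 0 with hr | hr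
  · exact hr.trans (by positivity)
  · rw [elog2, if_neg hr.not_ge] at h
    have hlog : 2 * Real.logb 2 r < x := EReal.coe_lt_coe_iff.1 h
    exact (Real.logb_le_iff_le_rpow one_lt_two hr).1 (by linarith)

lemma hasWeight_of_renyiDiv_lt [DecidableEq X] [DecidableEq Y] {ζ : Matrix Y Y ℂ}
    (hζ : IsSubnormalised ζ) {α : Matrix (X × Y) (X × Y) ℂ} (hα : α.IsHermitian) {x : ℝ}
    (h : renyiDiv α ((1 : Matrix X X ℂ) ⊗ₖ ζ) < (x : EReal)) :
    HasWeight α ((2 : ℝ) ^ (x / 2)) := by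
  have hβ : ((1 : Matrix X X ℂ) ⊗ₖ ζ).PosSemidef := Matrix.PosSemidef.one.kronecker hζ.1
  have hsupp : supp α ≤ supp ((1 : Matrix X X ℂ) ⊗ₖ ζ) := by
    by_contra hsupp
    simp [renyiDiv, hsupp] at h
  rw [renyiDiv, if_pos hsupp, neg_div] at h
  refine ⟨suppPow ζ (1 / 4), _, isHermitian_suppPow _ _, ?_, ?_, le_rpow_of_two_mul_elog2_lt h, ?_⟩
  · simpa only [(isHermitian_suppPow _ _).eq] using
      Matrix.isHermitian_conjTranspose_mul_mul (suppPow ((1 : Matrix X X ℂ) ⊗ₖ ζ) (-(1 / 4))) hα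
  · have hfour : suppPow ζ (1 / 4) * suppPow ζ (1 / 4) *
        (suppPow ζ (1 / 4) * suppPow ζ (1 / 4)) = ζ := by
      rw [suppPow_mul_suppPow hζ.1, suppPow_mul_suppPow hζ.1]
      norm_num [suppPow_one hζ.1.isHermitian]
    rw [hfour]
    exact hζ.2
  · rw [← suppPow_one_kronecker hζ.1.isHermitian, suppPow_conj_suppPow_neg_conj hα hβ hsupp]

omit [Fintype Y] in
lemma traceFst_eq_sum (M : Matrix (X × Y) (X × Y) ℂ) :
    traceFst M = ∑ x, M.submatrix (fun y => (x, y)) fun y => (x, y) := by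
  ext y y'
  simp only [traceFst, Matrix.of_apply, Matrix.sum_apply, Matrix.submatrix_apply]

lemma IsSubnormalised.traceFst {M : Matrix (X × Y) (X × Y) ℂ} (hM : IsSubnormalised M) :
    IsSubnormalised (traceFst M) := by
  refine ⟨?_, (congrArg Complex.re (trace_traceFst M)).trans_le hM.2⟩
  rw [traceFst_eq_sum]
  exact Matrix.posSemidef_sum _ fun x _ => hM.1.submatrix _

variable [DecidableEq X]

lemma mulVec_ite_eq_zero_of_traceFst_mulVec_eq_zero {M : Matrix (X × Y) (X × Y) ℂ}
    (hM : M.PosSemidef) {w : Y → ℂ} (hw : (traceFst M).mulVec w = 0) (x : X) :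
    M.mulVec (fun p => if p.1 = x then w p.2 else 0) = 0 := by
  have hpos : ∀ z, 0 ≤ star w ⬝ᵥ (M.submatrix (fun y => (z, y)) fun y => (z, y)).mulVec w :=
    fun z => (hM.submatrix fun y => (z, y)).dotProduct_mulVec_nonneg w
  have hsum : ∑ z, star w ⬝ᵥ (M.submatrix (fun y => (z, y)) fun y => (z, y)).mulVec w = 0 := by
    rw [← dotProduct_sum, ← Matrix.sum_mulVec, ← traceFst_eq_sum, hw, dotProduct_zero]
  refine (hM.dotProduct_mulVec_zero_iff _).1 ?_
  refine Eq.trans ?_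
    ((Finset.sum_eq_zero_iff_of_nonneg fun z _ => hpos z).1 hsum x (Finset.mem_univ x))
  simp only [Matrix.mulVec, dotProduct, Fintype.sum_prod_type_right, Pi.star_apply,
    apply_ite (star : ℂ → ℂ), star_zero, ite_mul, zero_mul, mul_ite, mul_zero,
    Finset.sum_ite_eq', Finset.mem_univ, if_true, Matrix.submatrix_apply]

variable [DecidableEq Y] {ρ : Matrix (X × Y) (X × Y) ℂ} {ε : ℝ}

omit [DecidableEq Y] in
lemma supp_le_supp_one_kronecker_traceFst (hρ : IsSubnormalised ρ) :
    supp ρ ≤ supp ((1 : Matrix X X ℂ) ⊗ₖ traceFst ρ) := by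
  have hβ := Matrix.PosSemidef.one.kronecker hρ.traceFst.1 (n := X)
  refine supp_le_of_ker_le hρ.1.isHermitian hβ fun v hv => ?_
  have hblock : ∀ x, (traceFst ρ).mulVec (fun y => v (x, y)) = 0 := fun x => by
    ext y
    simpa [Matrix.mulVec, dotProduct, Fintype.sum_prod_type, Matrix.one_apply] using
      congrFun hv (x, y)
  have hv_sum : v = ∑ x, fun p : X × Y => if p.1 = x then v (x, p.2) else 0 := by
    ext p
    simp [Finset.sum_apply]
  rw [hv_sum, Matrix.mulVec_sum]
  exact Finset.sum_eq_zero fun x _ =>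
    mulVec_ite_eq_zero_of_traceFst_mulVec_eq_zero hρ.1 (hblock x) x

lemma smoothRenyiDiv_lt_top (hρ : IsSubnormalised ρ) (hε : 0 ≤ ε) :
    smoothRenyiDiv ε ρ ((1 : Matrix X X ℂ) ⊗ₖ traceFst ρ) < ⊤ := by
  have hself : schattenNorm 1 (ρ - ρ) ≤ ε * ρ.trace.re := by
    rw [sub_self, schattenNorm_one_zero]
    exact mul_nonneg hε (Complex.nonneg_iff.1 hρ.1.trace_nonneg).1
  refine (iInf₂_le ρ ⟨hρ, hself⟩).trans_lt ?_
  rw [renyiDiv, if_pos (supp_le_supp_one_kronecker_traceFst hρ), elog2]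
  split_ifs
  · rw [EReal.mul_bot_of_pos two_pos]
    exact bot_lt_top
  · exact_mod_cast EReal.coe_lt_top _

lemma exists_hasWeight_of_smoothRenyiDiv_lt (hρ : IsSubnormalised ρ) (hε : 0 ≤ ε) {x : ℝ}
    (h : smoothRenyiDiv ε ρ ((1 : Matrix X X ℂ) ⊗ₖ traceFst ρ) < (x : EReal)) :
    ∃ ρ', IsSubnormalised ρ' ∧ schattenNorm 1 (ρ' - ρ) ≤ ε ∧
      HasWeight ρ' ((2 : ℝ) ^ (x / 2)) := by
  simp only [smoothRenyiDiv, iInf_lt_iff] at h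
  obtain ⟨ρ', ⟨hρ', hdist⟩, hlt⟩ := h
  exact ⟨ρ', hρ', hdist.trans (mul_le_of_le_one_right hε hρ.2),
    hasWeight_of_renyiDiv_lt hρ.traceFst hρ'.1.isHermitian hlt⟩

end Renyi

section Exponent

lemma ofReal_le_add_mul_epow2 {L C c : ℝ} (hC : 0 ≤ C) (hc : 0 ≤ c) {z : EReal} (hz : z < ⊤)
    (h : ∀ t : ℝ, z < t → L ≤ C + c * (2 : ℝ) ^ t) :
    ENNReal.ofReal L ≤ ENNReal.ofReal C + ENNReal.ofReal c * epow2 z := by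
  induction z using EReal.rec with
  | top => exact absurd hz (lt_irrefl _)
  | bot =>
    have hlim : Filter.Tendsto (fun t : ℝ => C + c * (2 : ℝ) ^ t) Filter.atBot (nhds C) := by
      simpa using ((tendsto_rpow_atBot_of_base_gt_one 2 one_lt_two).const_mul c).const_add C
    rw [epow2, if_pos rfl, mul_zero, add_zero]
    exact ENNReal.ofReal_le_ofReal
      (ge_of_tendsto' hlim fun t => h t (EReal.bot_lt_coe t))
  | coe s =>
    have hcont : Continuous fun t : ℝ => C + c * (2 : ℝ) ^ t :=
      ((Real.continuous_const_rpow two_ne_zero).const_mul c).const_add C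
    have hle : L ≤ C + c * (2 : ℝ) ^ s :=
      ge_of_tendsto (hcont.continuousWithinAt (s := Set.Ioi s))
        (Filter.eventually_of_mem self_mem_nhdsWithin fun t ht => h t (EReal.coe_lt_coe ht))
    rw [epow2, if_neg (EReal.coe_ne_bot _), if_neg (EReal.coe_ne_top _), EReal.toReal_coe,
      ← ENNReal.ofReal_mul hc, ← ENNReal.ofReal_add hC (by positivity)]
    exact ENNReal.ofReal_le_ofReal hle

lemma exists_lt_lt_add_div_two_eq {a b : EReal} (ha : a < ⊤) (hb : b < ⊤) {t : ℝ}
    (h : -((1 / 2 : ℝ) : EReal) * -a - ((1 / 2 : ℝ) : EReal) * -b < t) :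
    ∃ x y : ℝ, a < x ∧ b < y ∧ x / 2 + y / 2 = t := by
  obtain ⟨x₀, hx₀, -⟩ := EReal.lt_iff_exists_real_btwn.1 ha
  obtain ⟨y₀, hy₀, -⟩ := EReal.lt_iff_exists_real_btwn.1 hb
  induction a using EReal.rec with
  | top => exact absurd ha (lt_irrefl _)
  | bot => exact ⟨2 * t - y₀, y₀, EReal.bot_lt_coe _, hy₀, by ring⟩
  | coe a =>
    induction b using EReal.rec with
    | top => exact absurd hb (lt_irrefl _)
    | bot => exact ⟨x₀, 2 * t - x₀, hx₀, EReal.bot_lt_coe _, by ring⟩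
    | coe b =>
      have hab : -(1 / 2) * -a - 1 / 2 * -b < t := by exact_mod_cast h
      refine ⟨t + (a - b) / 2, t + (b - a) / 2, ?_, ?_, by ring⟩ <;> norm_cast <;> linarith

lemma neg_half_mul_neg_sub_half_mul_neg_lt_top {a b : EReal} (ha : a < ⊤) (hb : b < ⊤) :
    -((1 / 2 : ℝ) : EReal) * -a - ((1 / 2 : ℝ) : EReal) * -b < ⊤ := by
  induction a using EReal.rec with
  | top => exact absurd ha (lt_irrefl _)
  | bot =>
    induction b using EReal.rec with
    | top => exact absurd hb (lt_irrefl _)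
    | bot => simp [EReal.coe_mul_top_of_pos]
    | coe b => simp [EReal.coe_mul_top_of_pos]
  | coe a =>
    induction b using EReal.rec with
    | top => exact absurd hb (lt_irrefl _)
    | bot => simp [EReal.coe_mul_top_of_pos]
    | coe b => exact_mod_cast EReal.coe_lt_top _

end Exponent

section Choi

variable {k : ℕ} {A : Fin k → Type*} [∀ i, Fintype (A i)] [∀ i, DecidableEq (A i)] {B R : Type*}

lemma eprAll_apply (x a x' a' : ∀ i, A i) :
    eprAll A (x, a) (x', a') =
      if x = a ∧ x' = a' then (∏ i, (Fintype.card (A i) : ℂ))⁻¹ else 0 := by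
  simp only [eprAll, epr, Matrix.of_apply, Finset.prod_ite_zero, Finset.prod_inv_distrib]
  refine if_congr ?_ rfl rfl
  simp [funext_iff, forall_and]

lemma choiState_apply (T : Matrix (∀ i, A i) (∀ i, A i) ℂ →ₗ[ℂ] Matrix B B ℂ)
    (a a' : ∀ i, A i) (b b' : B) :
    choiState T (a, b) (a', b') =
      (∏ i, (Fintype.card (A i) : ℂ))⁻¹ * T (Matrix.single a a' 1) b b' := by
  have hsingle : (Matrix.of fun x x' => eprAll A (x, a) (x', a')) =
      (∏ i, (Fintype.card (A i) : ℂ))⁻¹ • Matrix.single a a' (1 : ℂ) := by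
    ext x x'
    simp [eprAll_apply, Matrix.single_apply, eq_comm]
  simp only [choiState, Matrix.submatrix_apply, ampliate, Matrix.of_apply, Prod.swap, hsingle,
    map_smul, Matrix.smul_apply, smul_eq_mul]

lemma map_apply_eq_sum {X : Type*} [Fintype X] [DecidableEq X]
    (T : Matrix X X ℂ →ₗ[ℂ] Matrix B B ℂ) (M : Matrix X X ℂ) (b b' : B) :
    T M b b' = ∑ a, ∑ a', M a a' * T (Matrix.single a a' 1) b b' := by
  conv_lhs => rw [Matrix.matrix_eq_sum_single M]
  simp only [map_sum, Matrix.sum_apply]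
  refine Finset.sum_congr rfl fun a _ => Finset.sum_congr rfl fun a' _ => ?_
  rw [← mul_one (M a a'), ← smul_eq_mul, ← Matrix.smul_single, map_smul, Matrix.smul_apply,
    smul_eq_mul, smul_eq_mul, mul_one]

lemma kronecker_one_conj_apply {X : Type*} [Fintype X] [Fintype R] [DecidableEq R]
    (V : Matrix X X ℂ) (ρ : Matrix (X × R) (X × R) ℂ) (a a' : X) (r r' : R) :
    ((V ⊗ₖ (1 : Matrix R R ℂ)) * ρ * (V ⊗ₖ (1 : Matrix R R ℂ))ᴴ) (a, r) (a', r') =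
      ∑ c, ∑ c', V a c * ρ (c, r) (c', r') * star (V a' c') := by
  simp only [Matrix.mul_apply, Matrix.conjTranspose_apply, Fintype.sum_prod_type,
    Matrix.kroneckerMap_apply, Matrix.one_apply, mul_ite, mul_one, mul_zero, ite_mul, zero_mul,
    Finset.sum_ite_eq, Finset.mem_univ, if_true, apply_ite (star : ℂ → ℂ), star_zero,
    Finset.sum_mul]
  rw [Finset.sum_comm]

omit [∀ i, DecidableEq (A i)] in
lemma prodKernel_conjKernel_apply (V : ∀ i, Matrix (A i) (A i) ℂ) (a c a' c' : ∀ i, A i) :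
    prodKernel (fun i => conjKernel (V i)) (a, c) (a', c') =
      (∏ i, (Fintype.card (A i) : ℂ)) * (tensorOp V a c * star (tensorOp V a' c')) := by
  simp only [prodKernel_apply, conjKernel, Matrix.smul_apply, smul_eq_mul, Matrix.of_apply,
    tensorOp, star_prod, Finset.prod_mul_distrib]

lemma perturbedState_eq_link [Fintype R] [DecidableEq R]
    (T : Matrix (∀ i, A i) (∀ i, A i) ℂ →ₗ[ℂ] Matrix B B ℂ)
    (ρ : Matrix ((∀ i, A i) × R) ((∀ i, A i) × R) ℂ) (U : ∀ i, Matrix.unitaryGroup (A i) ℂ) :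
    perturbedState T ρ U = link (choiState T) (prodKernel fun i => conjKernel (U i).1) ρ := by
  ext p q
  rw [perturbedState, ampliate, Matrix.of_apply, map_apply_eq_sum, link_apply,
    Fintype.sum_prod_type]
  refine Finset.sum_congr rfl fun a _ => ?_
  simp only [Fintype.sum_prod_type, Matrix.of_apply, kronecker_one_conj_apply, choiState_apply,
    prodKernel_conjKernel_apply]
  rw [Finset.sum_comm]
  refine Finset.sum_congr rfl fun a' _ => ?_
  have hcard : (∏ i, (Fintype.card (A i) : ℂ)) ≠ 0 := Finset.prod_ne_zero_iff.2 fun i _ =>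
    haveI : Nonempty (A i) := ⟨a i⟩
    Nat.cast_ne_zero.2 Fintype.card_ne_zero
  simp only [Finset.sum_mul]
  refine Finset.sum_congr rfl fun c _ => Finset.sum_congr rfl fun c' _ => ?_
  field_simp

variable [Fintype B]

lemma IsCompletelyPositive.posSemidef_ampliate {X C : Type*} [Fintype X] [Fintype C]
    {T : Matrix X X ℂ →ₗ[ℂ] Matrix B B ℂ} (hT : IsCompletelyPositive T)
    {M : Matrix (X × C) (X × C) ℂ} (hM : M.PosSemidef) : (ampliate C T M).PosSemidef := by
  let e := Fintype.equivFin C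
  convert (hT _ _ (hM.submatrix (Prod.map id e.symm))).submatrix (Prod.map id e) using 1
  ext p q
  simp [ampliate]

lemma posSemidef_eprAll : (eprAll A).PosSemidef := posSemidef_prodKernel fun i => by
  open scoped MatrixOrder in
  exact Matrix.nonneg_iff_posSemidef.1 (isStarProjection_epr (A i)).nonneg

lemma trace_choiState (T : Matrix (∀ i, A i) (∀ i, A i) ℂ →ₗ[ℂ] Matrix B B ℂ) :
    (choiState T).trace = (Fintype.card (∀ i, A i) : ℂ)⁻¹ * (T 1).trace := by
  simp only [Matrix.trace, Matrix.diag_apply, Fintype.sum_prod_type_right, Finset.mul_sum]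
  refine Finset.sum_congr rfl fun b _ => ?_
  simp only [map_apply_eq_sum T 1, Matrix.one_apply, ite_mul, one_mul, zero_mul,
    Finset.sum_ite_eq, Finset.mem_univ, if_true, Finset.mul_sum, choiState_apply,
    Fintype.card_pi, Nat.cast_prod]

lemma isSubnormalised_choiState {T : Matrix (∀ i, A i) (∀ i, A i) ℂ →ₗ[ℂ] Matrix B B ℂ}
    (hT : IsCompletelyPositive T) (hT' : IsTraceNonincreasing T) :
    IsSubnormalised (choiState T) := by
  refine ⟨(hT.posSemidef_ampliate posSemidef_eprAll).submatrix _, ?_⟩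
  have htrace : (T 1).trace.re ≤ Fintype.card (∀ i, A i) := by
    simpa only [Matrix.trace_one, Complex.natCast_re] using hT' 1 Matrix.PosSemidef.one
  rw [trace_choiState, ← Complex.ofReal_natCast, ← Complex.ofReal_inv, Complex.re_ofReal_mul]
  exact (mul_le_mul_of_nonneg_left htrace (by positivity)).trans inv_mul_le_one

end Choi

section Decomposition

variable {k : ℕ} {A : Fin k → Type*} [∀ i, Fintype (A i)] {B R : Type*}

lemma IsSubnormalised.submatrix_equiv {X Y : Type*} [Fintype X] [Fintype Y] {M : Matrix X X ℂ}
    (hM : IsSubnormalised M) (e : Y ≃ X) : IsSubnormalised (M.submatrix e e) := by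
  refine ⟨hM.1.submatrix e, ?_⟩
  have htrace : (M.submatrix e e).trace = M.trace := e.sum_comp M.diag
  rw [htrace]
  exact hM.2

lemma IsSubnormalised.marginal [Fintype R] {M : Matrix ((∀ i, A i) × R) ((∀ i, A i) × R) ℂ}
    (hM : IsSubnormalised M) (S : Finset (Fin k)) : IsSubnormalised (marginal S M) :=
  (hM.submatrix_equiv ((Equiv.prodAssoc _ _ _).symm.trans (((Equiv.prodComm _ _).trans
    (Equiv.piEquivPiSubtypeProd (· ∈ S) A).symm).prodCongr (Equiv.refl R)))).traceFst

lemma isHermitian_marginal {M : Matrix ((∀ i, A i) × R) ((∀ i, A i) × R) ℂ} (hM : M.IsHermitian)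
    (S : Finset (Fin k)) : (marginal S M).IsHermitian := by
  ext p q
  simp only [marginal, Matrix.conjTranspose_apply, Matrix.of_apply, star_sum, hM.apply]

lemma sum_filter_nonempty {ι M : Type*} [Fintype ι] [AddCommGroup M]
    (f : Finset ι → M) : ∑ S with S.Nonempty, f S = ∑ S, f S - f ∅ := by
  classical
  rw [← Finset.sum_erase_eq_sub (Finset.mem_univ ∅)]
  exact Finset.sum_congr (by ext S; simp [Finset.nonempty_iff_ne_empty]) fun _ _ => rfl

lemma sum_two_pow_card (ι : Type*) [Fintype ι] :
    ∑ S : Finset ι with S.Nonempty, (2 : ℝ) ^ S.card = 3 ^ Fintype.card ι - 1 := by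
  have h := Fintype.sum_pow_mul_eq_add_pow ι (2 : ℝ) 1
  simp only [one_pow, mul_one] at h
  rw [sum_filter_nonempty, h, Finset.card_empty, pow_zero]
  norm_num

variable [∀ i, DecidableEq (A i)]

lemma link_prodKernel_ite_eq_link_marginal (S : Finset (Fin k))
    (τ : Matrix ((∀ i, A i) × B) ((∀ i, A i) × B) ℂ)
    (ρ : Matrix ((∀ i, A i) × R) ((∀ i, A i) × R) ℂ) (U : ∀ i, Matrix.unitaryGroup (A i) ℂ) :
    link τ (prodKernel fun i => if i ∈ S then centredKernel (U i).1 else 1) ρ =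
      link (marginal S τ) (centredProd (S.restrict U)) (marginal S ρ) := by
  refine link_eq_link_partialTrace (Equiv.piEquivPiSubtypeProd (· ∈ S) A).symm
    (Equiv.piEquivPiSubtypeProd (· ∈ S) A).symm τ ρ fun x x' y y' => ?_
  rw [prodKernel_piEquivPiSubtypeProd_symm, ← prodKernel_one]
  congr 2
  · exact Subsingleton.elim _ _
  · exact funext fun i => if_pos i.2
  · exact funext fun i => if_neg i.2

lemma perturbedState_sub_eq_sum [Fintype R] [DecidableEq R]
    (T : Matrix (∀ i, A i) (∀ i, A i) ℂ →ₗ[ℂ] Matrix B B ℂ)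
    (ρ : Matrix ((∀ i, A i) × R) ((∀ i, A i) × R) ℂ) (U : ∀ i, Matrix.unitaryGroup (A i) ℂ) :
    perturbedState T ρ U - traceFst (choiState T) ⊗ₖ traceFst ρ =
      ∑ S : Finset (Fin k) with S.Nonempty,
        link (marginal S (choiState T)) (centredProd (S.restrict U)) (marginal S ρ) := by
  have hsplit : (fun i => conjKernel (U i).1) = fun i => centredKernel (U i).1 + 1 :=
    funext fun i => (sub_add_cancel _ _).symm
  simp only [← link_prodKernel_ite_eq_link_marginal]
  rw [perturbedState_eq_link, hsplit, prodKernel_add, sum_filter_nonempty, map_sum,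
    LinearMap.sum_apply]
  simp only [Finset.notMem_empty, if_false, prodKernel_one, link_one]

end Decomposition

section Entropy

variable {k : ℕ} {A : Fin k → Type*} [∀ i, Fintype (A i)] [∀ i, DecidableEq (A i)]
  {B R : Type*} [Fintype B] [DecidableEq B] [Fintype R] [DecidableEq R]

lemma integral_piHaar_restrict (S : Finset (Fin k))
    {f : (∀ i : S, Matrix.unitaryGroup (A i) ℂ) → ℝ} (hf : Continuous f) :
    ∫ U, f (S.restrict U) ∂piHaar A = ∫ V, f V ∂piHaar fun i : S => A i := by
  rw [piHaar, ← Measure.infinitePi_eq_pi]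
  exact integral_restrict_infinitePi (μ := fun i => haarUnitary (A i))
    (integrable_of_continuous hf).aestronglyMeasurable

lemma ofReal_integral_schattenNorm_one_link_marginal_le (hA : ∀ i, 2 ≤ Fintype.card (A i))
    {τ : Matrix ((∀ i, A i) × B) ((∀ i, A i) × B) ℂ} (hτ : IsSubnormalised τ)
    {ρ : Matrix ((∀ i, A i) × R) ((∀ i, A i) × R) ℂ} (hρ : IsSubnormalised ρ)
    {ε : ℝ} (hε : 0 ≤ ε) (S : Finset (Fin k)) :
    ENNReal.ofReal (∫ U, schattenNorm 1
        (link (marginal S τ) (centredProd (S.restrict U)) (marginal S ρ)) ∂piHaar A) ≤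
      ENNReal.ofReal (2 * 2 ^ S.card * ε) +
        ENNReal.ofReal (∏ s ∈ S, (1 - ((Fintype.card (A s) : ℝ) ^ 2)⁻¹) ^ (-1 / 2 : ℝ)) *
          epow2 (-((1 / 2 : ℝ) : EReal) * smoothCondEntropy ε (marginal S ρ) -
            ((1 / 2 : ℝ) : EReal) * smoothCondEntropy ε (marginal S τ)) := by
  have hτS := hτ.marginal S
  have hρS := hρ.marginal S
  have hdτ := smoothRenyiDiv_lt_top hτS hε
  have hdρ := smoothRenyiDiv_lt_top hρS hε
  rw [integral_piHaar_restrict S (continuous_schattenNorm_one_link_centredProd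
    hτS.1.isHermitian hρS.1.isHermitian), ← Finset.prod_coe_sort]
  refine ofReal_le_add_mul_epow2 (by positivity) prod_one_sub_inv_sq_rpow_nonneg
    (neg_half_mul_neg_sub_half_mul_neg_lt_top hdρ hdτ) fun t ht => ?_
  obtain ⟨x, y, hx, hy, rfl⟩ := exists_lt_lt_add_div_two_eq hdρ hdτ ht
  obtain ⟨ρ', hρ', hρε, hρx⟩ := exists_hasWeight_of_smoothRenyiDiv_lt hρS hε hx
  obtain ⟨τ', -, hτε, hτy⟩ := exists_hasWeight_of_smoothRenyiDiv_lt hτS hε hy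
  rw [Real.rpow_add two_pos, ← Fintype.card_coe S]
  exact integral_schattenNorm_one_link_centredProd_le_of_near (A := fun i : S => A i)
    (fun i => hA i) hτS hρS.1.isHermitian hρ' hτε hρε hρx hτy

lemma lintegral_schattenNorm_one_perturbedState_sub_le
    {T : Matrix (∀ i, A i) (∀ i, A i) ℂ →ₗ[ℂ] Matrix B B ℂ} (hτ : (choiState T).IsHermitian)
    {ρ : Matrix ((∀ i, A i) × R) ((∀ i, A i) × R) ℂ} (hρ : ρ.IsHermitian) :
    ∫⁻ U, ENNReal.ofReal (schattenNorm 1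
        (perturbedState T ρ U - traceFst (choiState T) ⊗ₖ traceFst ρ)) ∂piHaar A ≤
      ∑ S : Finset (Fin k) with S.Nonempty, ENNReal.ofReal (∫ U, schattenNorm 1 (link
        (marginal S (choiState T)) (centredProd (S.restrict U)) (marginal S ρ)) ∂piHaar A) := by
  let L (S : Finset (Fin k)) (U : ∀ i, Matrix.unitaryGroup (A i) ℂ) : Matrix (B × R) (B × R) ℂ :=
    link (marginal S (choiState T)) (centredProd (S.restrict U)) (marginal S ρ)
  have hL : ∀ S U, (L S U).IsHermitian := fun S U =>
    isHermitian_link (isHermitian_marginal hτ S) (isHermitian_centredProd _)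
      (isHermitian_marginal hρ S)
  have hcont : ∀ S, Continuous fun U => schattenNorm 1 (L S U) := fun S =>
    (continuous_schattenNorm_one_link_centredProd (isHermitian_marginal hτ S)
      (isHermitian_marginal hρ S)).comp (Pi.continuous_domRestrict _)
  calc
    _ ≤ ∫⁻ U, ∑ S : Finset (Fin k) with S.Nonempty,
        ENNReal.ofReal (schattenNorm 1 (L S U)) ∂piHaar A := lintegral_mono fun U => by
      rw [perturbedState_sub_eq_sum,
        ← ENNReal.ofReal_sum_of_nonneg fun S _ => schattenNorm_one_nonneg (hL S U)]
      exact ENNReal.ofReal_le_ofReal (schattenNorm_one_sum_le _ fun S => hL S U)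
    _ = ∑ S : Finset (Fin k) with S.Nonempty,
        ∫⁻ U, ENNReal.ofReal (schattenNorm 1 (L S U)) ∂piHaar A :=
      lintegral_finsetSum _ fun S _ => (hcont S).measurable.ennreal_ofReal
    _ = _ := Finset.sum_congr rfl fun S _ =>
      (ofReal_integral_eq_lintegral_ofReal (integrable_of_continuous (hcont S))
        (Filter.Eventually.of_forall fun U => schattenNorm_one_nonneg (hL S U))).symm

omit [∀ i, DecidableEq (A i)] in
lemma prod_one_sub_inv_sq_rpow_le_coeffD {S : Finset (Fin k)} (hS : S.Nonempty) :
    ∏ s ∈ S, (1 - ((Fintype.card (A s) : ℝ) ^ 2)⁻¹) ^ (-1 / 2 : ℝ) ≤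
      2 ^ S.card * coeffD A S := by
  have hpow : (1 : ℝ) ≤ 2 ^ S.card := one_le_pow₀ one_le_two
  have hzpow : (1 : ℝ) ≤ 2 ^ ((S.card : ℤ) - 1) :=
    one_le_zpow₀ one_le_two (by have := hS.card_pos; omega)
  rw [coeffD, ← mul_assoc, ← Finset.prod_coe_sort]
  exact le_mul_of_one_le_left prod_one_sub_inv_sq_rpow_nonneg
    (one_le_mul_of_one_le_of_one_le hpow hzpow)

end Entropy

end Decoupling

end

theorem mainTheorem2_general {k : ℕ}
    {A : Fin k → Type*} [∀ i, Fintype (A i)] [∀ i, DecidableEq (A i)]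
    {B R : Type*} [Fintype B] [DecidableEq B] [Fintype R] [DecidableEq R]
    (hA : ∀ i, 2 ≤ Fintype.card (A i))
    {T : Matrix (∀ i, A i) (∀ i, A i) ℂ →ₗ[ℂ] Matrix B B ℂ}
    (hT : Decoupling.IsSubnormalised (Decoupling.choiState T))
    {ρ : Matrix ((∀ i, A i) × R) ((∀ i, A i) × R) ℂ} (hρ : Decoupling.IsSubnormalised ρ)
    {ε : ℝ} (hε : 0 ≤ ε) :
    ∫⁻ U : (∀ i, Matrix.unitaryGroup (A i) ℂ),
        ENNReal.ofReal (Decoupling.schattenNorm 1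
          (Decoupling.perturbedState T ρ U -
            Decoupling.traceFst (Decoupling.choiState T) ⊗ₖ Decoupling.traceFst ρ))
        ∂(Measure.pi fun i => Decoupling.haarUnitary (A i)) ≤
      ENNReal.ofReal (2 * (3 ^ k - 1) * ε) +
        ∑ S : Finset (Fin k) with S.Nonempty,
          ENNReal.ofReal (∏ s ∈ S, (1 - ((Fintype.card (A s) : ℝ) ^ 2)⁻¹) ^ (-1 / 2 : ℝ)) *
            Decoupling.epow2
              (-((1 / 2 : ℝ) : EReal) *
                  Decoupling.smoothCondEntropy ε (Decoupling.marginal S ρ) -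
                ((1 / 2 : ℝ) : EReal) *
                  Decoupling.smoothCondEntropy ε
                    (Decoupling.marginal S (Decoupling.choiState T))) := by
  open Decoupling in
  have herror : ∑ S : Finset (Fin k) with S.Nonempty, ENNReal.ofReal (2 * 2 ^ S.card * ε) =
      ENNReal.ofReal (2 * (3 ^ k - 1) * ε) := by
    rw [← ENNReal.ofReal_sum_of_nonneg fun S _ => by positivity, ← Finset.sum_mul,
      ← Finset.mul_sum, sum_two_pow_card, Fintype.card_fin]
  rw [← herror, ← Finset.sum_add_distrib]
  exact (lintegral_schattenNorm_one_perturbedState_sub_le hT.1.isHermitian hρ.1.isHermitian).trans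
    (Finset.sum_le_sum fun S _ => ofReal_integral_schattenNorm_one_link_marginal_le hA hT hρ hε S)

theorem mainTheorem2 (k : ℕ) (hk : 0 < k)
    (A : Fin k → Type*) [∀ i, Fintype (A i)] [∀ i, DecidableEq (A i)]
    (B R : Type*) [Fintype B] [DecidableEq B] [Fintype R] [DecidableEq R]
    (hA : ∀ i, 2 ≤ Fintype.card (A i))
    (T : Matrix (∀ i, A i) (∀ i, A i) ℂ →ₗ[ℂ] Matrix B B ℂ)
    (hT : Decoupling.IsCompletelyPositive T) (hT' : Decoupling.IsTraceNonincreasing T)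
    (ρ : Matrix ((∀ i, A i) × R) ((∀ i, A i) × R) ℂ) (hρ : Decoupling.IsSubnormalised ρ)
    (ε : ℝ) (hε₀ : 0 < ε) (hε₁ : ε < 1) :
    ∫⁻ U : (∀ i, Matrix.unitaryGroup (A i) ℂ),
        ENNReal.ofReal (Decoupling.schattenNorm 1
          (Decoupling.perturbedState T ρ U -
            Decoupling.traceFst (Decoupling.choiState T) ⊗ₖ Decoupling.traceFst ρ))
        ∂(Measure.pi fun i => Decoupling.haarUnitary (A i)) ≤
      ENNReal.ofReal (2 * (3 ^ k - 1) * ε) +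
        ∑ S : Finset (Fin k) with S.Nonempty,
          ENNReal.ofReal (2 ^ S.card * Decoupling.coeffD A S) *
            Decoupling.epow2
              (-((1 / 2 : ℝ) : EReal) *
                  Decoupling.smoothCondEntropy ε (Decoupling.marginal S ρ) -
                ((1 / 2 : ℝ) : EReal) *
                  Decoupling.smoothCondEntropy ε
                    (Decoupling.marginal S (Decoupling.choiState T))) := by
  open Decoupling in
  exact (mainTheorem2_general hA (isSubnormalised_choiState hT hT') hρ hε₀.le).trans <| by
    gcongr with S hS
    exact prod_one_sub_inv_sq_rpow_le_coeffD (Finset.mem_filter.1 hS).2
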